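/- Let $n\ge 1$ and let $k\in C(\mathbb R^n)\cap L^\infty(\mathbb R^n)$ satisfy $k\ge 0$, $k(0)>0$ and $\int_{\mathbb R^n}k(x)\,dx=1$. Let $\Omega_0\subset\mathbb R^n$ be a smooth bounded domain, $\ell_0>0$ a constant, and let $\gamma_0\in L^\infty(\mathbb R^n)$ satisfy $\gamma_0=-\ell_0$ on $\mathbb R^n\setminus\bar\Omega_0$, $\gamma_0|_{\bar\Omega_0}\ge 0$, $\gamma_0|_{\bar\Omega_0}\not\equiv 0$ and $\gamma_0|_{\bar\Omega_0}\in C(\bar\Omega_0)$. For $d>0$ let $\gamma$ be a classical solution of the nonlocal one-phase Stefan problem $$\gamma_t(t,x)=d\int_{\{y:\gamma(t,y)>0\}}k(x-y)\gamma(t,y)\,dy-d\,\gamma(t,x)\chi_{\{\gamma(t,x)>0\}}\quad(t>0,\ x\in\mathbb R^n),\qquad \gamma(0,x)=\gamma_0(x)\quad(x\in\mathbb R^n),$$ that is, $\gamma(t,\cdot)\in L^\infty(\mathbb R^n)$ for every $t>0$ and, for every $x\in\mathbb R^n$, the function $t\mapsto\gamma(t,x)$ is continuous at $t=0$ and differentiable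 at every $t>0$, and the two equations above hold. Put $\Omega(t)=\{x\in\mathbb R^n:\gamma(t,x)\ge 0\}$ for $t\ge 0$. Then: (i) (Expansion) there is $t_0>0$ such that $\Omega(t)=\Omega(0)$ for $0\le t\le t_0$, and $\Omega(t_1)\subseteq\Omega(t_2)$ whenever $0<t_1<t_2$; (ii) (Boundedness) there is $R>0$, depending only on the kernel $k$ and the initial data $(\Omega_0,\ell_0,\gamma_0)$ and in particular not on $d$ or $t$, such that $\Omega(t)\subseteq B_R(0)$ for all $t>0$. -/

import Mathlib

open MeasureTheory Set Filter Topology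
open scoped ContDiff

noncomputable section

namespace NonlocalStefan

/-- The space `ℝⁿ` with its Euclidean norm and Lebesgue measure. -/
abbrev E (n : ℕ) : Type := EuclideanSpace ℝ (Fin n)

/-- Assumption (K) on the kernel: `k ∈ C(ℝⁿ) ∩ L^∞(ℝⁿ)`, `k ≥ 0`, `k(0) > 0`, `∫ k = 1`.
Integrability of `k` is forced by the last condition, because the Bochner integral of a
non-integrable function is `0`. -/
structure IsKernel {n : ℕ} (k : E n → ℝ) : Prop where
  continuous : Continuous k
  memLp_top : MemLp k ⊤ volume
  nonneg : ∀ x, 0 ≤ k x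
  pos_zero : 0 < k 0
  integral_eq_one : ∫ x, k x = 1

/-- A smooth bounded domain: a nonempty, connected, bounded open set which near each of its
boundary points is the sublevel set `{φ < 0}` of a `C^∞` function with nonvanishing differential
at that point. -/
structure IsSmoothBoundedDomain {n : ℕ} (Ω : Set (E n)) : Prop where
  isOpen : IsOpen Ω
  isConnected : IsConnected Ω
  isBounded : Bornology.IsBounded Ω
  smooth_boundary : ∀ p ∈ frontier Ω, ∃ (U : Set (E n)) (φ : E n → ℝ),
    IsOpen U ∧ p ∈ U ∧ ContDiffOn ℝ ∞ φ U ∧ fderiv ℝ φ p ≠ 0 ∧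
      ∀ x ∈ U, x ∈ Ω ↔ φ x < 0

/-- One-phase initial data: `γ₀ ∈ L^∞`, `γ₀ = -ℓ₀` off the closure of `Ω₀`, and on the closure of
`Ω₀` it is nonnegative and not identically zero. -/
structure IsOnePhaseInitialData {n : ℕ} (Ω₀ : Set (E n)) (ℓ₀ : ℝ) (γ₀ : E n → ℝ) : Prop where
  memLp_top : MemLp γ₀ ⊤ volume
  eq_outside : ∀ x, x ∉ closure Ω₀ → γ₀ x = -ℓ₀
  nonneg_inside : ∀ x ∈ closure Ω₀, 0 ≤ γ₀ x
  not_identically_zero : ∃ x ∈ closure Ω₀, γ₀ x ≠ 0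

/-- `γ` is a (global, classical) solution of the nonlocal one-phase Stefan problem
`γ_t(t,x) = d ∫_{γ(t,·)>0} k(x-y) γ(t,y) dy - d γ(t,x) χ_{γ(t,x)>0}` for `t > 0`, `x ∈ ℝⁿ`,
`γ(0,x) = γ₀(x)`, with `γ(t,·) ∈ L^∞(ℝⁿ)`. Only the values of `γ` at times `t ≥ 0` matter. -/
structure IsSolution {n : ℕ} (d : ℝ) (k γ₀ : E n → ℝ) (γ : ℝ → E n → ℝ) : Prop where
  memLp_top : ∀ t, 0 < t → MemLp (γ t) ⊤ volume
  initial : ∀ x, γ 0 x = γ₀ x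
  continuous_zero : ∀ x, ContinuousWithinAt (fun s => γ s x) (Ici 0) 0
  equation : ∀ t, 0 < t → ∀ x,
    HasDerivAt (fun s => γ s x)
      (d * (∫ y in {y | 0 < γ t y}, k (x - y) * γ t y)
        - d * indicator {y | 0 < γ t y} (γ t) x) t

/-- `Ω(t) = {x ∈ ℝⁿ | γ(t,x) ≥ 0}`. -/
def region {n : ℕ} (γ : ℝ → E n → ℝ) (t : ℝ) : Set (E n) := {x | 0 ≤ γ t x}

end NonlocalStefan

end

open MeasureTheory Set Filter Topology
open scoped Pointwise

noncomputable section

namespace NonlocalStefan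

/-! Write γ⁺ for the positive part, so that the equation reads γ_t = d(k * γ⁺ - γ⁺). Where γ ≤ 0 the
loss term vanishes and γ cannot decrease, so nonnegativity persists (`IsSolution.nonneg_of_nonneg`).
The gain term is bounded on bounded time intervals, so a point starting at -ℓ₀ needs a definite time
to reach 0.

For boundedness, let w(t) = d ∫₀ᵗ γ⁺ ds. Integrating the equation gives γ(t) - γ₀ = k * w - w almost
everywhere (`IsSolution.exists_accumulated`). With D the closure of Ω₀ and G an upper bound of γ₀ on
D, the function k * w - w is at least -G on D, nonnegative off D, and at least ℓ₀ on {w > 0} off D.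
Its integral is 0, so |{w > 0}| is bounded uniformly in time (`IsTame.volume_pos_le`). On functions
of bounded support measure the form ∫ w (w - k * w) controls ∫ w² (`exists_spectral_gap`), and it is
at most G ∫_D w; hence w is bounded in L², uniformly in time. Since w increases in time, one
integrable majorant dominates every w(t)², so k * w(t) tends to 0 at infinity uniformly in t. Far
away γ(t, x) ≤ -ℓ₀ + (k * w(t))(x) < 0.

The radius does not depend on d: by uniqueness (`IsSolution.unique`), solutions for different d
differ only by a rescaling of time. -/

/-- Comparison of increments from comparison of derivatives. -/
lemma sub_le_sub_of_hasDerivAt_le {f g f' g' : ℝ → ℝ} {a b : ℝ} (hab : a ≤ b)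
    (hf : ContinuousOn f (Icc a b)) (hg : ContinuousOn g (Icc a b))
    (hf' : ∀ x ∈ Ioo a b, HasDerivAt f (f' x) x) (hg' : ∀ x ∈ Ioo a b, HasDerivAt g (g' x) x)
    (hle : ∀ x ∈ Ioo a b, f' x ≤ g' x) : f b - f a ≤ g b - g a := by
  have hmono : MonotoneOn (fun x => g x - f x) (Icc a b) := by
    apply monotoneOn_of_deriv_nonneg (convex_Icc a b) (hg.sub hf)
    · rw [interior_Icc]
      exact fun x hx => ((hg' x hx).sub (hf' x hx)).differentiableAt.differentiableWithinAt
    · rw [interior_Icc]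
      intro x hx
      have h := ((hg' x hx).sub (hf' x hx)).deriv
      change 0 ≤ deriv (g - f) x
      rw [h]
      linarith [hle x hx]
  have := hmono (left_mem_Icc.2 hab) (right_mem_Icc.2 hab) hab
  simp only at this
  linarith

/-! ### Convolution with the kernel -/

/-- The convolution `∫ k(x - y) f(y) dy`. -/
def kconv {n : ℕ} (k f : E n → ℝ) (x : E n) : ℝ := ∫ y, k (x - y) * f y

variable {n : ℕ} {k : E n → ℝ}

lemma IsKernel.integrable (hk : IsKernel k) : Integrable k :=
  integrable_of_integral_eq_one hk.integral_eq_one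

lemma IsKernel.integrable_sub_left (hk : IsKernel k) (x : E n) :
    Integrable (fun y => k (x - y)) :=
  hk.integrable.comp_sub_left x

lemma IsKernel.integral_sub_left (hk : IsKernel k) (x : E n) : ∫ y, k (x - y) = 1 := by
  rw [integral_sub_left_eq_self k volume x, hk.integral_eq_one]

lemma IsKernel.integrable_mul_of_bdd (hk : IsKernel k) {f : E n → ℝ} {C : ℝ}
    (hf : AEStronglyMeasurable f) (hb : ∀ᵐ y, |f y| ≤ C) (x : E n) :
    Integrable (fun y => k (x - y) * f y) :=
  (hk.integrable_sub_left x).mul_bdd hf hb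

lemma kconv_nonneg (hk : IsKernel k) {f : E n → ℝ} (hf : ∀ᵐ y, 0 ≤ f y) (x : E n) :
    0 ≤ kconv k f x :=
  integral_nonneg_of_ae (hf.mono fun _ hy => mul_nonneg (hk.nonneg _) hy)

lemma kconv_mono (hk : IsKernel k) {f g : E n → ℝ} (x : E n)
    (hf : Integrable (fun y => k (x - y) * f y)) (hg : Integrable (fun y => k (x - y) * g y))
    (h : ∀ᵐ y, f y ≤ g y) : kconv k f x ≤ kconv k g x :=
  integral_mono_ae hf hg (h.mono fun _ hy => mul_le_mul_of_nonneg_left hy (hk.nonneg _))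

lemma kconv_const (hk : IsKernel k) (C : ℝ) (x : E n) : kconv k (fun _ => C) x = C := by
  rw [kconv, integral_mul_const, hk.integral_sub_left, one_mul]

lemma kconv_const_mul (c : ℝ) (f : E n → ℝ) (x : E n) :
    kconv k (fun y => c * f y) x = c * kconv k f x := by
  rw [kconv, kconv, ← integral_const_mul]
  congr 1
  ext y
  ring

lemma kconv_congr {f g : E n → ℝ} (h : f =ᵐ[volume] g) (x : E n) : kconv k f x = kconv k g x :=
  integral_congr_ae (h.mono fun y hy => by simp only [hy])

/-- A convolution of the kernel with a function of absolute value at most `C` is at most `C`. -/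
lemma abs_kconv_le (hk : IsKernel k) {f : E n → ℝ} {C : ℝ} (hb : ∀ᵐ y, |f y| ≤ C) (x : E n) :
    |kconv k f x| ≤ C := by
  rw [← kconv_const hk C x]
  refine (abs_integral_le_integral_abs).trans ?_
  refine integral_mono_of_nonneg (Eventually.of_forall fun y => abs_nonneg _)
    ((hk.integrable_sub_left x).mul_const C) (hb.mono fun y hy => ?_)
  simp only [abs_mul, abs_of_nonneg (hk.nonneg _)]
  exact mul_le_mul_of_nonneg_left hy (hk.nonneg _)

/-- The positive part of `γ(t, ·)`. -/
def posPart (γ : ℝ → E n → ℝ) (t : ℝ) (x : E n) : ℝ := max (γ t x) 0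

lemma posPart_nonneg (γ : ℝ → E n → ℝ) (t : ℝ) (x : E n) : 0 ≤ posPart γ t x := le_max_right _ _

lemma le_posPart (γ : ℝ → E n → ℝ) (t : ℝ) (x : E n) : γ t x ≤ posPart γ t x := le_max_left _ _

/-! ### Pointwise monotonicity in time and short-time behaviour -/

section Solution

variable {d : ℝ} {γ₀ : E n → ℝ} {γ : ℝ → E n → ℝ}

lemma IsSolution.memLp (h : IsSolution d k γ₀ γ) (h0 : MemLp γ₀ ⊤ volume) {t : ℝ} (ht : 0 ≤ t) :
    MemLp (γ t) ⊤ volume := by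
  rcases ht.eq_or_lt with rfl | ht
  · rwa [show γ 0 = γ₀ from funext h.initial]
  · exact h.memLp_top t ht

lemma IsSolution.aestronglyMeasurable_posPart (h : IsSolution d k γ₀ γ)
    (h0 : MemLp γ₀ ⊤ volume) {t : ℝ} (ht : 0 ≤ t) :
    AEStronglyMeasurable (posPart γ t) volume :=
  (h.memLp h0 ht).1.sup aestronglyMeasurable_const

/-- The restricted integral and the indicator both see only the positive part, which makes the
right-hand side Lipschitz in γ although the indicator jumps. -/
lemma IsSolution.hasDerivAt (h : IsSolution d k γ₀ γ) {t : ℝ} (ht : 0 < t) (x : E n) :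
    HasDerivAt (fun s => γ s x) (d * kconv k (posPart γ t) x - d * posPart γ t x) t := by
  have hm : NullMeasurableSet {y | 0 < γ t y} volume :=
    nullMeasurableSet_lt aemeasurable_const (h.memLp_top t ht).1.aemeasurable
  have h1 : (∫ y in {y | 0 < γ t y}, k (x - y) * γ t y) = kconv k (posPart γ t) x := by
    rw [← integral_indicator₀ hm, kconv]
    congr 1
    ext y
    by_cases hy : 0 < γ t y
    · simp [indicator, hy, posPart, max_eq_left hy.le]
    · simp [indicator, hy, posPart, max_eq_right (not_lt.1 hy)]
  have h2 : indicator {y | 0 < γ t y} (γ t) x = posPart γ t x := by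
    by_cases hy : 0 < γ t x
    · simp [indicator, hy, posPart, max_eq_left hy.le]
    · simp [indicator, hy, posPart, max_eq_right (not_lt.1 hy)]
  have := h.equation t ht x
  rwa [h1, h2] at this

lemma IsSolution.continuousOn (h : IsSolution d k γ₀ γ) (x : E n) :
    ContinuousOn (fun s => γ s x) (Ici 0) := by
  intro t ht
  rcases (mem_Ici.1 ht).eq_or_lt with rfl | ht
  · exact h.continuous_zero x
  · exact (h.hasDerivAt ht x).continuousAt.continuousWithinAt

lemma IsSolution.continuousOn_Icc (h : IsSolution d k γ₀ γ) (x : E n) {s t : ℝ} (hs : 0 ≤ s) :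
    ContinuousOn (fun s => γ s x) (Icc s t) :=
  (h.continuousOn x).mono fun _ hr => hs.trans hr.1

lemma kconv_posPart_nonneg (hk : IsKernel k) (γ : ℝ → E n → ℝ) (t : ℝ) (x : E n) :
    0 ≤ kconv k (posPart γ t) x :=
  kconv_nonneg hk (Eventually.of_forall fun _ => posPart_nonneg _ _ _) x

/-- As long as `γ(·, x)` stays nonpositive it does not decrease. -/
lemma IsSolution.le_of_nonpos (hk : IsKernel k) (hd : 0 < d) (h : IsSolution d k γ₀ γ) {s t : ℝ}
    (hs : 0 ≤ s) (hst : s ≤ t) {x : E n} (hneg : ∀ r ∈ Ioo s t, γ r x ≤ 0) : γ s x ≤ γ t x := by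
  have := sub_le_sub_of_hasDerivAt_le (f := fun _ => (0 : ℝ)) (f' := fun _ => 0) hst
    continuousOn_const (h.continuousOn_Icc x hs) (fun r _ => hasDerivAt_const r 0)
    (fun r hr => h.hasDerivAt (hs.trans_lt hr.1) x) (fun r hr => by
      have h1 : posPart γ r x = 0 := max_eq_right (hneg r hr)
      rw [h1, mul_zero, sub_zero]
      exact mul_nonneg hd.le (kconv_posPart_nonneg hk γ r x))
  linarith

/-- Nonnegativity of `γ(·, x)` persists. -/
lemma IsSolution.nonneg_of_nonneg (hk : IsKernel k) (hd : 0 < d) (h : IsSolution d k γ₀ γ)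
    {s t : ℝ} (hs : 0 ≤ s) (hst : s ≤ t) {x : E n} (hsx : 0 ≤ γ s x) : 0 ≤ γ t x := by
  -- Take the last time σ in [s, t] at which the value is nonnegative; afterwards it is negative,
  -- hence nondecreasing.
  have hc : IsCompact (Icc s t ∩ (fun r => γ r x) ⁻¹' Ici 0) :=
    isCompact_Icc.of_isClosed_subset
      ((h.continuousOn_Icc x hs).preimage_isClosed_of_isClosed isClosed_Icc isClosed_Ici)
      inter_subset_left
  obtain ⟨σ, hσ⟩ := hc.exists_isGreatest ⟨s, left_mem_Icc.2 hst, hsx⟩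
  refine le_trans (b := γ σ x) hσ.1.2 ?_
  refine h.le_of_nonpos hk hd (hs.trans hσ.1.1.1) hσ.1.1.2 fun r hr => ?_
  by_contra hr0
  exact absurd (hσ.2 ⟨⟨hσ.1.1.1.trans hr.1.le, hr.2.le⟩, (not_le.1 hr0).le⟩) (not_le.2 hr.1)

/-- `e^{dt} γ⁺(t, x)` is nondecreasing in time. -/
lemma IsSolution.posPart_le (hk : IsKernel k) (hd : 0 < d) (h : IsSolution d k γ₀ γ)
    {s t : ℝ} (hs : 0 ≤ s) (hst : s ≤ t) (x : E n) :
    posPart γ s x ≤ Real.exp (d * (t - s)) * posPart γ t x := by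
  have hR : 0 ≤ Real.exp (d * (t - s)) * posPart γ t x :=
    mul_nonneg (Real.exp_pos _).le (posPart_nonneg _ _ _)
  refine max_le ?_ hR
  rcases le_total (γ s x) 0 with h0 | h0
  · exact h0.trans hR
  -- From time s on γ⁺ = γ, and the integrating factor exp(d(r - s)) cancels the loss term, leaving
  -- a nonnegative derivative.
  have hpos : ∀ r, s ≤ r → posPart γ r x = γ r x := fun r hr =>
    max_eq_left (h.nonneg_of_nonneg hk hd hs hr h0)
  have hexp : ∀ r, HasDerivAt (fun r => Real.exp (d * (r - s)))
      (Real.exp (d * (r - s)) * d) r := fun r => by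
    have := (((hasDerivAt_id r).sub_const s).const_mul d).exp
    simpa using this
  have := sub_le_sub_of_hasDerivAt_le (f := fun _ => (0 : ℝ)) (f' := fun _ => 0)
    (g := fun r => Real.exp (d * (r - s)) * γ r x) hst
    continuousOn_const ((Continuous.continuousOn (by fun_prop)).mul (h.continuousOn_Icc x hs))
    (fun r _ => hasDerivAt_const r 0)
    (fun r hr => (hexp r).mul (h.hasDerivAt (hs.trans_lt hr.1) x)) (fun r hr => by
      have h2 := kconv_posPart_nonneg hk γ r x
      rw [hpos r hr.1.le]
      have : Real.exp (d * (r - s)) * d * γ r x +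
          Real.exp (d * (r - s)) * (d * kconv k (posPart γ r) x - d * γ r x) =
          Real.exp (d * (r - s)) * (d * kconv k (posPart γ r) x) := by ring
      rw [this]
      positivity)
  rw [hpos t hst]
  simp only [sub_self, mul_zero, Real.exp_zero, one_mul] at this
  linarith

/-- The positive part is bounded, uniformly on bounded time intervals. -/
lemma IsSolution.exists_posPart_bound (hk : IsKernel k) (hd : 0 < d) (h : IsSolution d k γ₀ γ)
    (h0 : MemLp γ₀ ⊤ volume) {T : ℝ} (hT : 0 ≤ T) :
    ∃ C, 0 < C ∧ ∀ᵐ y, ∀ t ∈ Icc 0 T, posPart γ t y ≤ C := by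
  -- Only the essential bound at the final time is needed: the monotonicity of e^{dt} γ⁺ carries it
  -- back to all earlier times, outside a single null set.
  have hM : ∃ C, ∀ᵐ y, ‖γ T y‖ ≤ C := by
    have hlt := (h.memLp h0 hT).2
    rw [eLpNorm_exponent_top] at hlt
    refine ⟨(eLpNormEssSup (γ T) volume).toReal, ?_⟩
    filter_upwards [ae_le_eLpNormEssSup (f := γ T) (μ := volume)] with y hy
    rw [← toReal_enorm]
    exact ENNReal.toReal_mono hlt.ne hy
  obtain ⟨C, hC⟩ := hM
  refine ⟨Real.exp (d * T) * (|C| + 1), by positivity, hC.mono fun y hy t ht => ?_⟩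
  refine (h.posPart_le hk hd ht.1 ht.2 y).trans ?_
  have h1 : posPart γ T y ≤ |C| + 1 :=
    max_le (by linarith [le_abs_self (γ T y), le_abs_self C, hy, Real.norm_eq_abs (γ T y)])
      (by positivity)
  refine mul_le_mul (Real.exp_le_exp.2 ?_) h1 (posPart_nonneg _ _ _) (Real.exp_pos _).le
  exact mul_le_mul_of_nonneg_left (by linarith [ht.1]) hd.le

lemma IsSolution.integrable_kernel_mul_posPart (hk : IsKernel k) (hd : 0 < d)
    (h : IsSolution d k γ₀ γ) (h0 : MemLp γ₀ ⊤ volume) {t : ℝ} (ht : 0 ≤ t) (x : E n) :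
    Integrable (fun y => k (x - y) * posPart γ t y) := by
  obtain ⟨C, -, hC⟩ := h.exists_posPart_bound hk hd h0 ht
  exact hk.integrable_mul_of_bdd (h.aestronglyMeasurable_posPart h0 ht) (hC.mono fun y hy => by
    rw [abs_of_nonneg (posPart_nonneg _ _ _)]
    exact hy t (right_mem_Icc.2 ht)) x

/-- If the nonlocal term at `x` is at most `M` on `(s, t)`, then `γ(·, x)` grows at most by
`d M (t - s)`. -/
lemma IsSolution.le_add_of_kconv_le (hd : 0 < d) (h : IsSolution d k γ₀ γ) {s t M : ℝ}
    (hs : 0 ≤ s) (hst : s ≤ t) {x : E n} (hM : ∀ r ∈ Ioo s t, kconv k (posPart γ r) x ≤ M) :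
    γ t x ≤ γ s x + d * M * (t - s) := by
  have := sub_le_sub_of_hasDerivAt_le (g := fun r => d * M * r) hst
    (h.continuousOn_Icc x hs) (Continuous.continuousOn (by fun_prop))
    (fun r hr => h.hasDerivAt (hs.trans_lt hr.1) x)
    (fun r _ => (hasDerivAt_id r).const_mul (d * M)) (fun r hr => by
      have h1 := mul_le_mul_of_nonneg_left (hM r hr) hd.le
      have h2 := mul_nonneg hd.le (posPart_nonneg γ r x)
      linarith)
  linarith

/-- The region does not move for a short time. -/
theorem IsSolution.exists_region_eq (hk : IsKernel k) (hd : 0 < d) {Ω₀ : Set (E n)} {ℓ₀ : ℝ}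
    (hℓ₀ : 0 < ℓ₀) (h0 : IsOnePhaseInitialData Ω₀ ℓ₀ γ₀) (h : IsSolution d k γ₀ γ) :
    ∃ t₀ : ℝ, 0 < t₀ ∧ ∀ t, 0 ≤ t → t ≤ t₀ → region γ t = region γ 0 := by
  obtain ⟨C, hC0, hC⟩ := h.exists_posPart_bound hk hd h0.memLp_top zero_le_one
  -- The growth rate is at most d C, so the rise from -ℓ₀ is at most ℓ₀ / 2; the 1 keeps t in the
  -- interval where C is valid.
  refine ⟨min 1 (ℓ₀ / (2 * (d * C))), by positivity, fun t ht0 ht => ?_⟩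
  refine Subset.antisymm (fun x hx => ?_) fun x hx => h.nonneg_of_nonneg hk hd le_rfl ht0 hx
  by_contra hx0
  have hxΩ : x ∉ closure Ω₀ := fun hmem => hx0 (by
    simpa [region, h.initial] using h0.nonneg_inside x hmem)
  have h1 := h.le_add_of_kconv_le hd le_rfl ht0 (x := x) (M := C) (fun r hr => by
    refine (le_abs_self _).trans (abs_kconv_le hk (hC.mono fun y hy => ?_) x)
    rw [abs_of_nonneg (posPart_nonneg _ _ _)]
    exact hy r ⟨hr.1.le, hr.2.le.trans (ht.trans (min_le_left _ _))⟩)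
  rw [h.initial, h0.eq_outside x hxΩ] at h1
  have h2 : t ≤ ℓ₀ / (2 * (d * C)) := ht.trans (min_le_right _ _)
  rw [le_div_iff₀ (by positivity)] at h2
  have h3 : 0 ≤ γ t x := hx
  nlinarith

/-! ### Uniqueness and time rescaling -/

/-- A step of the Gronwall iteration. -/
lemma abs_le_half_mul_exp {f f' : ℝ → ℝ} {C T t : ℝ} (ht : t ∈ Icc 0 T)
    (hC : 0 ≤ C) (hf : ContinuousOn f (Icc 0 T)) (hf0 : f 0 = 0)
    (hf' : ∀ s ∈ Ioo 0 T, HasDerivAt f (f' s) s)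
    (hle : ∀ s ∈ Ioo 0 T, |f' s| ≤ 2 * d * (C * Real.exp (4 * d * s))) :
    |f t| ≤ C / 2 * Real.exp (4 * d * t) := by
  have hsub : Icc 0 t ⊆ Icc 0 T := Icc_subset_Icc_right ht.2
  have hsub' : Ioo 0 t ⊆ Ioo 0 T := Ioo_subset_Ioo_right ht.2
  -- The exponent 4d is twice the Lipschitz constant 2d of the equation, so integrating in the
  -- weighted norm gains a factor 1/2.
  have hg : ∀ s, HasDerivAt (fun s => C / 2 * Real.exp (4 * d * s))
      (2 * d * (C * Real.exp (4 * d * s))) s := fun s => by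
    have := (((hasDerivAt_id s).const_mul (4 * d)).exp).const_mul (C / 2)
    refine this.congr_deriv ?_
    simp only [id]
    ring
  have hgc : ContinuousOn (fun s => C / 2 * Real.exp (4 * d * s)) (Icc 0 t) :=
    Continuous.continuousOn (by fun_prop)
  have h1 := sub_le_sub_of_hasDerivAt_le ht.1 (hf.mono hsub) hgc
    (fun s hs => hf' s (hsub' hs)) (fun s _ => hg s)
    (fun s hs => (le_abs_self _).trans (hle s (hsub' hs)))
  have h2 := sub_le_sub_of_hasDerivAt_le ht.1 (hf.mono hsub).neg hgc
    (fun s hs => (hf' s (hsub' hs)).neg) (fun s _ => hg s)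
    (fun s hs => (neg_le_abs _).trans (hle s (hsub' hs)))
  simp only [hf0, mul_zero, Real.exp_zero, Pi.neg_apply] at h1 h2
  exact abs_le.2 ⟨by linarith, by linarith⟩

lemma eq_zero_of_abs_le_pow {a b : ℝ} (h : ∀ m : ℕ, |a| ≤ b * (1 / 2) ^ m) : a = 0 := by
  have ht : Tendsto (fun m : ℕ => b * (1 / 2 : ℝ) ^ m) atTop (𝓝 (b * 0)) :=
    (tendsto_pow_atTop_nhds_zero_of_lt_one (by norm_num) (by norm_num)).const_mul b
  rw [mul_zero] at ht
  exact abs_nonpos_iff.1 (ge_of_tendsto' ht h)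

/-- Solutions are determined by their initial values. -/
theorem IsSolution.unique (hk : IsKernel k) (hd : 0 < d) (h0 : MemLp γ₀ ⊤ volume)
    {γ' : ℝ → E n → ℝ} (h : IsSolution d k γ₀ γ) (h' : IsSolution d k γ₀ γ') {t : ℝ}
    (ht : 0 ≤ t) (x : E n) : γ t x = γ' t x := by
  have hlip : ∀ s y, |posPart γ s y - posPart γ' s y| ≤ |γ s y - γ' s y| := fun s y =>
    abs_max_sub_max_le_abs _ _ _
  have hder : ∀ s y, 0 < s → HasDerivAt (fun s => γ s y - γ' s y)
      (d * kconv k (fun z => posPart γ s z - posPart γ' s z) y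
        - d * (posPart γ s y - posPart γ' s y)) s := fun s y hs => by
    refine ((h.hasDerivAt hs y).sub (h'.hasDerivAt hs y)).congr_deriv ?_
    have : kconv k (fun z => posPart γ s z - posPart γ' s z) y =
        kconv k (posPart γ s) y - kconv k (posPart γ' s) y := by
      rw [kconv, kconv, kconv, ← integral_sub
        (h.integrable_kernel_mul_posPart hk hd h0 hs.le y)
        (h'.integrable_kernel_mul_posPart hk hd h0 hs.le y)]
      simp only [mul_sub]
    rw [this]
    ring
  have hcont : ∀ y, ContinuousOn (fun s => γ s y - γ' s y) (Icc 0 t) := fun y =>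
    (h.continuousOn_Icc y le_rfl).sub (h'.continuousOn_Icc y le_rfl)
  have hini : ∀ y, γ 0 y - γ' 0 y = 0 := fun y => by rw [h.initial, h'.initial, sub_self]
  have hpow : ∀ (C : ℝ) (m : ℕ), C * (1 / 2) ^ (m + 1) = C * (1 / 2) ^ m / 2 := fun C m => by
    rw [pow_succ]; ring
  obtain ⟨C₁, hC₁0, hC₁⟩ := h.exists_posPart_bound hk hd h0 ht
  obtain ⟨C₂, hC₂0, hC₂⟩ := h'.exists_posPart_bound hk hd h0 ht
  have hexp1 : ∀ s, 0 ≤ s → 1 ≤ Real.exp (4 * d * s) := fun s hs =>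
    Real.one_le_exp (by positivity)
  -- The weighted iteration runs first for almost every point, since the starting bound on γ⁺ holds
  -- only there.
  have hae : ∀ m : ℕ, ∀ᵐ y, ∀ s ∈ Icc 0 t,
      |posPart γ s y - posPart γ' s y| ≤ (C₁ + C₂) * (1 / 2) ^ m * Real.exp (4 * d * s) := by
    intro m
    induction m with
    | zero =>
      filter_upwards [hC₁, hC₂] with y h1 h2 s hs
      have e := hexp1 s hs.1
      have a1 := h1 s hs
      have a2 := h2 s hs
      have b1 := posPart_nonneg γ s y
      have b2 := posPart_nonneg γ' s y
      rw [pow_zero, mul_one]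
      refine (abs_le.2 ⟨by linarith, by linarith⟩ : _ ≤ C₁ + C₂).trans ?_
      nlinarith
    | succ m ih =>
      filter_upwards [ih] with y hy s hs
      refine (hlip s y).trans ?_
      rw [hpow]
      refine abs_le_half_mul_exp hs (by positivity) (hcont y) (hini y)
        (fun r hr => hder r y hr.1) fun r hr => ?_
      have hr' : r ∈ Icc 0 t := ⟨hr.1.le, hr.2.le⟩
      have h1 := abs_kconv_le hk (ih.mono fun z hz => hz r hr') y
      have h2 := hy r hr'
      rw [← mul_sub, abs_mul, abs_of_pos hd]
      have h3 := abs_sub (kconv k (fun z => posPart γ r z - posPart γ' r z) y)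
        (posPart γ r y - posPart γ' r y)
      nlinarith
  -- The convolution ignores null sets, so the nonlocal terms agree at every point. What remains at
  -- x is a scalar equation, iterated below from the bound given by continuity on [0, t].
  have hzero : ∀ s ∈ Icc 0 t, ∀ y, kconv k (fun z => posPart γ s z - posPart γ' s z) y = 0 := by
    intro s hs y
    refine eq_zero_of_abs_le_pow (b := (C₁ + C₂) * Real.exp (4 * d * s)) fun m => ?_
    refine abs_kconv_le hk ((hae m).mono fun z hz => (hz s hs).trans (le_of_eq ?_)) y
    ring
  obtain ⟨C, hC⟩ := isCompact_Icc.exists_bound_of_continuousOn (hcont x)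
  have hC0 : 0 ≤ C := (norm_nonneg _).trans (hC 0 (left_mem_Icc.2 ht))
  have hx : ∀ m : ℕ, ∀ s ∈ Icc 0 t,
      |γ s x - γ' s x| ≤ C * (1 / 2) ^ m * Real.exp (4 * d * s) := by
    intro m
    induction m with
    | zero =>
      intro s hs
      have e := hexp1 s hs.1
      have := hC s hs
      rw [Real.norm_eq_abs] at this
      rw [pow_zero, mul_one]
      nlinarith
    | succ m ih =>
      intro s hs
      rw [hpow]
      refine abs_le_half_mul_exp hs (by positivity) (hcont x) (hini x)
        (fun r hr => hder r x hr.1) fun r hr => ?_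
      have hr' : r ∈ Icc 0 t := ⟨hr.1.le, hr.2.le⟩
      rw [hzero r hr' x, mul_zero, zero_sub, abs_neg, abs_mul, abs_of_pos hd]
      have h1 := (hlip r x).trans (ih r hr')
      have h2 : 0 ≤ C * (1 / 2) ^ m * Real.exp (4 * d * r) := by positivity
      nlinarith
  refine sub_eq_zero.1 (eq_zero_of_abs_le_pow (b := C * Real.exp (4 * d * t)) fun m => ?_)
  refine (hx m t (right_mem_Icc.2 ht)).trans (le_of_eq ?_)
  ring

/-- Rescaling of time. -/
lemma IsSolution.comp_mul (h : IsSolution d k γ₀ γ) {a : ℝ} (ha : 0 < a) :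
    IsSolution (a * d) k γ₀ (fun t => γ (a * t)) where
  memLp_top t ht := h.memLp_top _ (by positivity)
  initial x := by simpa using h.initial x
  continuous_zero x := by
    have h1 : ContinuousWithinAt (fun s => γ s x) (Ici 0) (a * 0) := by
      simpa using h.continuous_zero x
    exact h1.comp (f := fun t : ℝ => a * t) (Continuous.continuousWithinAt (by fun_prop))
      fun t ht => mul_nonneg ha.le ht
  equation t ht x := by
    have h1 := h.equation (a * t) (by positivity) x
    have h2 := h1.comp t ((hasDerivAt_id t).const_mul a)
    refine h2.congr_deriv ?_
    ring

end Solution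

/-! ### Propagation of integrability -/

lemma integrable_prod_kernel_mul (hk : IsKernel k) {f : E n → ℝ} (hf : Integrable f) :
    Integrable (fun p : E n × E n => k (p.1 - p.2) * f p.2) (volume.prod volume) := by
  have := hf.convolution_integrand (ContinuousLinearMap.mul ℝ ℝ) hk.integrable (μ := volume)
  refine this.congr (Eventually.of_forall fun p => ?_)
  simp [mul_comm]

lemma integrable_kconv (hk : IsKernel k) {f : E n → ℝ} (hf : Integrable f) :
    Integrable (kconv k f) :=
  (integrable_prod_kernel_mul hk hf).integral_prod_left

lemma integral_kconv (hk : IsKernel k) {f : E n → ℝ} (hf : Integrable f) :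
    ∫ x, kconv k f x = ∫ x, f x := by
  simp only [kconv]
  rw [integral_integral_swap (f := fun x y => k (x - y) * f y) (integrable_prod_kernel_mul hk hf)]
  congr 1
  ext y
  rw [integral_mul_const, integral_sub_right_eq_self k y, hk.integral_eq_one, one_mul]

/-- A bounded function `u ≥ 0` with `u ≤ g + (k * u) / 2` and `g` integrable is integrable. -/
lemma integrable_of_le_add_half_kconv (hk : IsKernel k) {u g : E n → ℝ} {C : ℝ}
    (hu : AEStronglyMeasurable u) (hu0 : ∀ y, 0 ≤ u y) (hC : ∀ᵐ y, u y ≤ C)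
    (hg : Integrable g) (hg0 : ∀ y, 0 ≤ g y)
    (hle : ∀ᵐ x, u x ≤ g x + 1 / 2 * kconv k u x) : Integrable u := by
  have hI : ∀ x, Integrable (fun y => k (x - y) * u y) :=
    hk.integrable_mul_of_bdd hu (hC.mono fun y hy => by rwa [abs_of_nonneg (hu0 y)])
  -- Integrating the inequality would presuppose ∫ u < ∞, so it is iterated instead: p ↦ g + (k * p)
  -- / 2 keeps ∫ p ≤ 2 ∫ g because k preserves mass, while the error C 2⁻ᵐ vanishes. Fatou
  -- concludes.
  have hstep : ∀ m : ℕ, ∃ p : E n → ℝ, Integrable p ∧ (∀ y, 0 ≤ p y) ∧ ∫ y, p y ≤ 2 * ∫ y, g y ∧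
      ∀ᵐ y, u y ≤ p y + C * (1 / 2) ^ m := by
    intro m
    induction m with
    | zero =>
      refine ⟨fun _ => 0, integrable_zero _ _ _, fun _ => le_rfl, ?_, by simpa using hC⟩
      have : 0 ≤ ∫ y, g y := integral_nonneg hg0
      simp only [integral_zero]
      linarith
    | succ m ih =>
      obtain ⟨p, hp, hp0, hpg, hup⟩ := ih
      refine ⟨fun y => g y + 1 / 2 * kconv k p y, hg.add ((integrable_kconv hk hp).const_mul _),
        fun y => add_nonneg (hg0 y)
          (mul_nonneg (by norm_num) (kconv_nonneg hk (Eventually.of_forall hp0) y)), ?_, ?_⟩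
      · rw [integral_add hg ((integrable_kconv hk hp).const_mul _), integral_const_mul,
          integral_kconv hk hp]
        linarith
      · filter_upwards [hle, (integrable_prod_kernel_mul hk hp).prod_right_ae] with x hx hpx
        have hc := (hk.integrable_sub_left x).mul_const (C * (1 / 2) ^ m)
        have hadd : Integrable (fun y => k (x - y) * (p y + C * (1 / 2) ^ m)) := by
          simp only [mul_add]
          exact hpx.add hc
        have h1 := kconv_mono hk x (hI x) hadd hup
        have h2 : kconv k (fun y => p y + C * (1 / 2) ^ m) x = kconv k p x + C * (1 / 2) ^ m := by
          have h3 := integral_add hpx hc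
          rw [integral_mul_const, hk.integral_sub_left, one_mul] at h3
          rw [kconv, kconv, ← h3]
          simp only [mul_add]
        rw [h2] at h1
        rw [pow_succ]
        linarith
  choose p hp hp0 hpg hup using hstep
  refine ⟨hu, ?_⟩
  rw [hasFiniteIntegral_iff_ofReal (Eventually.of_forall hu0)]
  have hall : ∀ᵐ y, ∀ m, u y ≤ p m y + C * (1 / 2) ^ m := ae_all_iff.2 hup
  have htend : Tendsto (fun m : ℕ => C * (1 / 2 : ℝ) ^ m) atTop (𝓝 0) := by
    simpa using (tendsto_pow_atTop_nhds_zero_of_lt_one (r := (1 / 2 : ℝ)) (by norm_num)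
      (by norm_num)).const_mul C
  calc ∫⁻ y, ENNReal.ofReal (u y)
      ≤ ∫⁻ y, liminf (fun m => ENNReal.ofReal (p m y)) atTop := by
        refine lintegral_mono_ae (hall.mono fun y hy => ?_)
        have h1 : Tendsto (fun m : ℕ => ENNReal.ofReal (u y - C * (1 / 2) ^ m)) atTop
            (𝓝 (ENNReal.ofReal (u y))) := by
          have := ENNReal.tendsto_ofReal (htend.const_sub (u y))
          simpa using this
        rw [← h1.liminf_eq]
        refine liminf_le_liminf (Eventually.of_forall fun m => ENNReal.ofReal_le_ofReal ?_)
        linarith [hy m]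
    _ ≤ liminf (fun m => ∫⁻ y, ENNReal.ofReal (p m y)) atTop :=
        lintegral_liminf_le' fun m => (hp m).1.aemeasurable.ennreal_ofReal
    _ ≤ liminf (fun _ : ℕ => ENNReal.ofReal (2 * ∫ y, g y)) atTop := by
        refine liminf_le_liminf (Eventually.of_forall fun m => ?_)
        rw [← ofReal_integral_eq_lintegral_ofReal (hp m) (Eventually.of_forall (hp0 m))]
        exact ENNReal.ofReal_le_ofReal (hpg m)
    _ < ⊤ := by
        rw [liminf_const]
        exact ENNReal.ofReal_lt_top

section Solution

variable {d : ℝ} {γ₀ : E n → ℝ} {γ : ℝ → E n → ℝ}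

/-- On so short an interval γ⁺(r) ≤ 2 γ⁺(t), so the time-integrated equation gives γ⁺(t) ≤ γ⁺(s) +
(k * γ⁺(t)) / 2, to which `integrable_of_le_add_half_kconv` applies. -/
lemma IsSolution.integrable_posPart_step (hk : IsKernel k) (hd : 0 < d) (h : IsSolution d k γ₀ γ)
    (h0 : MemLp γ₀ ⊤ volume) {s t : ℝ} (hs : 0 ≤ s) (hst : s ≤ t) (hlt : d * (t - s) ≤ 1 / 4)
    (hi : Integrable (posPart γ s)) : Integrable (posPart γ t) := by
  have ht := hs.trans hst
  obtain ⟨C, -, hC⟩ := h.exists_posPart_bound hk hd h0 ht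
  refine integrable_of_le_add_half_kconv hk (h.aestronglyMeasurable_posPart h0 ht)
    (posPart_nonneg γ t) (hC.mono fun y hy => hy t (right_mem_Icc.2 ht)) hi (posPart_nonneg γ s)
    (Eventually.of_forall fun x => ?_)
  have hQ := kconv_posPart_nonneg hk γ t x
  refine max_le ?_ (add_nonneg (posPart_nonneg _ _ _) (mul_nonneg (by norm_num) hQ))
  have h1 := h.le_add_of_kconv_le hd hs hst (x := x) (M := 2 * kconv k (posPart γ t) x)
    (fun r hr => by
      rw [← kconv_const_mul]
      refine kconv_mono hk x
        (h.integrable_kernel_mul_posPart hk hd h0 (hs.trans hr.1.le) x) ?_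
        (Eventually.of_forall fun y => ?_)
      · refine ((h.integrable_kernel_mul_posPart hk hd h0 ht x).const_mul 2).congr
          (Eventually.of_forall fun y => ?_)
        simp only
        ring
      · refine (h.posPart_le hk hd (hs.trans hr.1.le) hr.2.le y).trans
          (mul_le_mul_of_nonneg_right ?_ (posPart_nonneg _ _ _))
        have h2 : d * (t - r) ≤ 1 / 4 := by
          have := mul_le_mul_of_nonneg_left (show t - r ≤ t - s by linarith [hr.1]) hd.le
          linarith
        have h3 : Real.exp (d * (t - r)) ≤ 1 / (1 - d * (t - r)) :=
          Real.exp_bound_div_one_sub_of_interval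
            (mul_nonneg hd.le (by linarith [hr.2])) (by linarith)
        refine h3.trans ?_
        rw [div_le_iff₀ (by linarith)]
        linarith)
  have h2 : d * (2 * kconv k (posPart γ t) x) * (t - s) =
      d * (t - s) * (2 * kconv k (posPart γ t) x) := by ring
  have h3 := mul_le_mul_of_nonneg_right hlt (show 0 ≤ 2 * kconv k (posPart γ t) x by positivity)
  linarith [le_posPart γ s x]

/-- Integrability of the positive part propagates in time. -/
lemma IsSolution.integrable_posPart (hk : IsKernel k) (hd : 0 < d) (h : IsSolution d k γ₀ γ)
    (h0 : MemLp γ₀ ⊤ volume) (hi : Integrable (posPart γ 0)) {t : ℝ} (ht : 0 ≤ t) :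
    Integrable (posPart γ t) := by
  -- With m > 4 d t, each of the m steps of length t / m satisfies d t / m ≤ 1/4.
  obtain ⟨m, hm⟩ := exists_nat_gt (4 * d * t)
  have hm0 : (0 : ℝ) < m := lt_of_le_of_lt (by positivity) hm
  have key : ∀ j : ℕ, Integrable (posPart γ (j * (t / m))) := by
    intro j
    induction j with
    | zero => simpa using hi
    | succ j ih =>
      have hstep : (0 : ℝ) ≤ t / m := by positivity
      refine h.integrable_posPart_step hk hd h0 (by positivity) ?_ ?_ ih
      · push_cast
        nlinarith
      · have : d * (((j + 1 : ℕ) : ℝ) * (t / m) - j * (t / m)) = d * t / m := by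
          push_cast
          ring
        rw [this, div_le_iff₀ hm0]
        linarith
  have := key m
  rwa [mul_div_cancel₀ _ hm0.ne'] at this

/-! ### The accumulated heat -/

/-- A jointly measurable modification, on a null set of points, of the positive part of a
solution. -/
lemma IsSolution.exists_measurable_version (hk : IsKernel k) (hd : 0 < d)
    (h : IsSolution d k γ₀ γ) (h0 : MemLp γ₀ ⊤ volume) :
    ∃ v : ℝ → E n → ℝ, (∀ t, Measurable (v t)) ∧ (∀ x, Continuous fun t => v t x) ∧
      (∀ᵐ x, ∀ t, 0 ≤ t → v t x = posPart γ t x) ∧ (∀ t x, 0 ≤ v t x) ∧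
      (∀ s t x, 0 ≤ s → s ≤ t → v s x ≤ Real.exp (d * (t - s)) * v t x) ∧
      (∀ T, 0 ≤ T → ∃ C, 0 < C ∧ ∀ t ∈ Icc 0 T, ∀ x, v t x ≤ C) ∧
      (∀ t x, 0 ≤ t → 0 < v t x → 0 < γ t x) := by
  have hmeas : ∀ t, AEMeasurable (posPart γ (max t 0)) volume := fun t =>
    (h.aestronglyMeasurable_posPart h0 (le_max_right t 0)).aemeasurable
  have hbd : ∀ m : ℕ, ∃ C, 0 < C ∧ ∀ᵐ y, ∀ t ∈ Icc (0 : ℝ) m, posPart γ t y ≤ C := fun m =>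
    h.exists_posPart_bound hk hd h0 m.cast_nonneg
  choose C hC0 hC using hbd
  have hgood : ∀ᵐ y, (∀ q : ℚ, posPart γ (max (q : ℝ) 0) y = (hmeas q).mk _ y) ∧
      ∀ m : ℕ, ∀ t ∈ Icc (0 : ℝ) m, posPart γ t y ≤ C m :=
    (ae_all_iff.2 fun q : ℚ => (hmeas q).ae_eq_mk).and (ae_all_iff.2 hC)
  -- Measurable representatives are matched at rational times only, so one null set S suffices. The
  -- modification is 0 on S; measurability at other times follows from continuity in t.
  obtain ⟨S, hSsub, hSm, hS0⟩ := exists_measurable_superset_of_null (ae_iff.1 hgood)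
  have hS : ∀ y ∉ S, (∀ q : ℚ, posPart γ (max (q : ℝ) 0) y = (hmeas q).mk _ y) ∧
      ∀ m : ℕ, ∀ t ∈ Icc (0 : ℝ) m, posPart γ t y ≤ C m := fun y hy => by
    by_contra hcon
    exact hy (hSsub hcon)
  have hcont : ∀ x, Continuous fun t => Sᶜ.indicator (posPart γ (max t 0)) x := by
    intro x
    by_cases hx : x ∈ S
    · simpa [indicator, hx] using continuous_const
    · have h1 : Continuous fun t : ℝ => γ (max t 0) x :=
        (h.continuousOn x).comp_continuous (by fun_prop) fun t => mem_Ici.2 (le_max_right _ _)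
      simpa [indicator, hx, posPart] using h1.max continuous_const
  refine ⟨fun t => Sᶜ.indicator (posPart γ (max t 0)), fun t => ?_, hcont, ?_, ?_, ?_, ?_, ?_⟩
  · have hq : ∀ q : ℚ, Measurable (Sᶜ.indicator (posPart γ (max (q : ℝ) 0))) := fun q => by
      have : Sᶜ.indicator (posPart γ (max (q : ℝ) 0)) = Sᶜ.indicator ((hmeas q).mk _) :=
        indicator_congr fun y hy => (hS y hy).1 q
      rw [this]
      exact (hmeas q).measurable_mk.indicator hSm.compl
    obtain ⟨a, ha⟩ : ∃ a : ℕ → ℚ, Tendsto (fun i => (a i : ℝ)) atTop (𝓝 t) := by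
      obtain ⟨a, -, -, ha⟩ := Real.exists_seq_rat_strictMono_tendsto t
      exact ⟨a, ha⟩
    refine measurable_of_tendsto_metrizable (fun i => hq (a i)) (tendsto_pi_nhds.2 fun x => ?_)
    exact ((hcont x).tendsto t).comp ha
  · have : ∀ᵐ x, x ∉ S := measure_eq_zero_iff_ae_notMem.1 hS0
    filter_upwards [this] with x hx t ht
    simp [indicator, hx, max_eq_left ht]
  · exact fun t x => indicator_nonneg (fun y _ => posPart_nonneg _ _ _) x
  · intro s t x hs hst
    by_cases hx : x ∈ S
    · simp [indicator, hx]
    · simpa [indicator, hx, max_eq_left hs, max_eq_left (hs.trans hst)] using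
        h.posPart_le hk hd hs hst x
  · intro T _
    obtain ⟨m, hm⟩ := exists_nat_ge T
    refine ⟨C m, hC0 m, fun t ht x => ?_⟩
    by_cases hx : x ∈ S
    · simpa [indicator, hx] using (hC0 m).le
    · simpa [indicator, hx, max_eq_left ht.1] using (hS x hx).2 m t ⟨ht.1, ht.2.trans hm⟩
  · intro t x ht hpos
    by_cases hx : x ∈ S
    · simp [indicator, hx] at hpos
    · simpa [indicator, hx, max_eq_left ht, posPart] using hpos

/-- The integrated equation: there is an accumulated heat `w(t, x)`, nondecreasing in `t`, with
`γ(t) - γ₀ = k * w(t) - w(t)` almost everywhere and `γ(t) - γ₀ ≤ k * w(t)` everywhere. -/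
lemma IsSolution.exists_accumulated (hk : IsKernel k) (hd : 0 < d) (h : IsSolution d k γ₀ γ)
    (h0 : MemLp γ₀ ⊤ volume) (hi : Integrable (posPart γ 0)) :
    ∃ w : ℝ → E n → ℝ, (∀ t, 0 ≤ t → Measurable (w t)) ∧ (∀ t x, 0 ≤ t → 0 ≤ w t x) ∧
      (∀ s t x, 0 ≤ s → s ≤ t → w s x ≤ w t x) ∧ (∀ t, 0 ≤ t → Integrable (w t)) ∧
      (∀ t, 0 ≤ t → ∃ C, ∀ x, w t x ≤ C) ∧ (∀ t x, 0 ≤ t → 0 < w t x → 0 < γ t x) ∧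
      (∀ t, 0 ≤ t → ∀ᵐ x, γ t x - γ₀ x = kconv k (w t) x - w t x) ∧
      (∀ t, 0 ≤ t → ∀ x, γ t x - γ₀ x ≤ kconv k (w t) x) := by
  obtain ⟨v, hvm, hvc, hveq, hv0, hvexp, hvbd, hvpos⟩ := h.exists_measurable_version hk hd h0
  have hint : ∀ x a b, IntervalIntegrable (fun s => v s x) volume a b := fun x a b =>
    (hvc x).intervalIntegrable a b
  have huncurry : Measurable (Function.uncurry v) :=
    measurable_uncurry_of_continuous_of_measurable hvc hvm
  -- This bound by the final value yields integrability and boundedness of w, and shows that w > 0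
  -- forces γ > 0.
  have hwle : ∀ t x, 0 ≤ t → d * ∫ s in 0..t, v s x ≤ d * (t * (Real.exp (d * t) * v t x)) := by
    intro t x ht
    refine mul_le_mul_of_nonneg_left ?_ hd.le
    have := intervalIntegral.integral_mono_on ht (hint x 0 t)
      (intervalIntegrable_const (c := Real.exp (d * t) * v t x)) fun s hs => by
        refine (hvexp s t x hs.1 hs.2).trans (mul_le_mul_of_nonneg_right ?_ (hv0 t x))
        refine Real.exp_le_exp.2 (mul_le_mul_of_nonneg_left ?_ hd.le)
        linarith [hs.1]
    rwa [intervalIntegral.integral_const, sub_zero, smul_eq_mul] at this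
  have hwm : ∀ t, 0 ≤ t → Measurable fun x => d * ∫ s in 0..t, v s x := by
    intro t ht
    simp only [intervalIntegral.integral_of_le ht]
    refine Measurable.const_mul ?_ d
    have : StronglyMeasurable (fun p : E n × ℝ => v p.2 p.1) :=
      (huncurry.comp measurable_swap).stronglyMeasurable
    exact this.integral_prod_right.measurable
  have hw0 : ∀ t x, 0 ≤ t → 0 ≤ d * ∫ s in 0..t, v s x := fun t x ht =>
    mul_nonneg hd.le (intervalIntegral.integral_nonneg ht fun s _ => hv0 s x)
  have hvi : ∀ t, 0 ≤ t → Integrable (v t) := fun t ht =>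
    (h.integrable_posPart hk hd h0 hi ht).congr (hveq.mono fun x hx => (hx t ht).symm)
  have hkv : ∀ t, 0 ≤ t → ∀ x, kconv k (posPart γ t) x = kconv k (v t) x := fun t ht x =>
    kconv_congr (hveq.mono fun y hy => (hy t ht).symm) x
  -- The gain may use v, since convolution ignores null sets, but the loss keeps γ⁺ itself, so the
  -- identity holds at every x. Dropping the loss gives the everywhere inequality; replacing γ⁺ by v
  -- gives the almost everywhere identity.
  have heq : ∀ t, 0 ≤ t → ∀ x, γ t x - γ₀ x =
      kconv k (fun y => d * ∫ s in 0..t, v s y) x - d * ∫ s in 0..t, posPart γ s x := by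
    intro t ht x
    obtain ⟨C, hC0, hC⟩ := hvbd t ht
    have hprod : Integrable (Function.uncurry fun (s : ℝ) (y : E n) => k (x - y) * v s y)
        ((volume.restrict (uIoc 0 t)).prod volume) := by
      have h1 : Integrable (fun p : ℝ × E n => C * k (x - p.2))
          ((volume.restrict (uIoc 0 t)).prod volume) := by
        have hc : Integrable (fun _ : ℝ => C) (volume.restrict (uIoc 0 t)) :=
          integrableOn_const (by rw [uIoc_of_le ht]; exact measure_Ioc_lt_top.ne)
        exact hc.mul_prod (hk.integrable_sub_left x)
      have hm : Measurable (fun p : ℝ × E n => k (x - p.2) * v p.1 p.2) :=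
        (hk.continuous.measurable.comp (measurable_const.sub measurable_snd)).mul huncurry
      refine h1.mono hm.aestronglyMeasurable ?_
      have hae : ∀ᵐ p : ℝ × E n ∂((volume.restrict (uIoc 0 t)).prod volume), p.1 ∈ uIoc 0 t :=
        Measure.quasiMeasurePreserving_fst.ae (ae_restrict_mem measurableSet_uIoc)
      filter_upwards [hae] with p hp
      rw [uIoc_of_le ht] at hp
      rw [Function.uncurry_def, Real.norm_eq_abs, Real.norm_eq_abs, abs_mul, abs_mul, mul_comm,
        abs_of_nonneg (hv0 _ _), abs_of_pos hC0]
      exact mul_le_mul_of_nonneg_right (hC _ ⟨hp.1.le, hp.2⟩ _) (abs_nonneg _)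
    have hswap := intervalIntegral_integral_swap hprod
    have hIi : IntervalIntegrable (fun s => kconv k (v s) x) volume 0 t := by
      rw [intervalIntegrable_iff]
      exact hprod.integral_prod_left
    have hpc : ContinuousOn (fun s => posPart γ s x) (Icc 0 t) :=
      (h.continuousOn_Icc x le_rfl).sup continuousOn_const
    have hpi : IntervalIntegrable (fun s => posPart γ s x) volume 0 t :=
      hpc.intervalIntegrable_of_Icc ht
    have hftc := intervalIntegral.integral_eq_sub_of_hasDerivAt_of_le ht
      (h.continuousOn_Icc x le_rfl)
      (f' := fun s => d * kconv k (v s) x - d * posPart γ s x)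
      (fun s hs => by
        rw [← hkv s hs.1.le x]
        exact h.hasDerivAt hs.1 x) ((hIi.const_mul d).sub (hpi.const_mul d))
    rw [intervalIntegral.integral_sub (hIi.const_mul d) (hpi.const_mul d),
      intervalIntegral.integral_const_mul, intervalIntegral.integral_const_mul, h.initial] at hftc
    rw [← hftc, kconv_const_mul]
    congr 2
    simp only [kconv]
    rw [hswap]
    simp only [intervalIntegral.integral_const_mul]
  refine ⟨fun t x => d * ∫ s in 0..t, v s x, hwm, hw0, ?_, ?_, ?_, ?_, ?_, ?_⟩
  · intro s t x hs hst
    refine mul_le_mul_of_nonneg_left ?_ hd.le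
    exact intervalIntegral.integral_mono_interval le_rfl hs hst
      (Eventually.of_forall fun r => hv0 r x) (hint x 0 t)
  · intro t ht
    refine (((hvi t ht).const_mul (Real.exp (d * t))).const_mul t |>.const_mul d).mono
      (hwm t ht).aestronglyMeasurable (Eventually.of_forall fun x => ?_)
    rw [Real.norm_eq_abs, Real.norm_eq_abs, abs_of_nonneg (hw0 t x ht)]
    exact (hwle t x ht).trans (le_abs_self _)
  · intro t ht
    obtain ⟨C, hC0, hC⟩ := hvbd t ht
    refine ⟨d * (t * (Real.exp (d * t) * C)), fun x => (hwle t x ht).trans ?_⟩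
    have := hC t (right_mem_Icc.2 ht) x
    gcongr
  · intro t x ht hpos
    refine hvpos t x ht ((hv0 t x).lt_of_ne fun h0 => ?_)
    have := hwle t x ht
    rw [← h0, mul_zero, mul_zero, mul_zero] at this
    exact absurd hpos (not_lt.2 this)
  · intro t ht
    filter_upwards [hveq] with x hx
    rw [heq t ht x]
    congr 2
    refine intervalIntegral.integral_congr fun s hs => ?_
    rw [uIcc_of_le ht] at hs
    exact (hx s hs.1).symm
  · intro t ht x
    rw [heq t ht x]
    have h1 : 0 ≤ ∫ s in 0..t, posPart γ s x :=
      intervalIntegral.integral_nonneg ht fun s _ => posPart_nonneg γ s x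
    have := mul_nonneg hd.le h1
    linarith

end Solution

/-! ### Autocorrelation and the spectral gap -/

/-- The autocorrelation `h ↦ ∫ w(x) w(x - h) dx`. -/
def autocorr (w : E n → ℝ) (h : E n) : ℝ := ∫ x, w x * w (x - h)

/-- The class of nonnegative, measurable, integrable and bounded functions. -/
structure IsTame (w : E n → ℝ) : Prop where
  measurable : Measurable w
  integrable : Integrable w
  nonneg : ∀ x, 0 ≤ w x
  bounded : ∃ C, ∀ x, w x ≤ C

namespace IsTame

variable {w : E n → ℝ}

lemma exists_abs_bound (hw : IsTame w) : ∃ C, ∀ x, ‖w x‖ ≤ C := by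
  obtain ⟨C, hC⟩ := hw.bounded
  exact ⟨C, fun x => by rw [Real.norm_eq_abs, abs_of_nonneg (hw.nonneg x)]; exact hC x⟩

lemma integrable_mul_shift (hw : IsTame w) (g h : E n) :
    Integrable fun x => w (x - g) * w (x - h) := by
  obtain ⟨C, hC⟩ := hw.exists_abs_bound
  exact (hw.integrable.comp_sub_right g).mul_bdd
    (hw.integrable.comp_sub_right h).aestronglyMeasurable (Eventually.of_forall fun x => hC _)

lemma integrable_sq (hw : IsTame w) : Integrable fun x => w x ^ 2 := by
  simpa [sq] using hw.integrable_mul_shift 0 0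

lemma integrable_prod (hw : IsTame w) :
    Integrable (fun p : E n × E n => w p.2 * w (p.2 - p.1)) (volume.prod volume) := by
  have := hw.integrable.convolution_integrand (ContinuousLinearMap.mul ℝ ℝ)
    hw.integrable.comp_neg (μ := volume)
  refine this.congr (Eventually.of_forall fun p => ?_)
  simp

lemma integrable_autocorr (hw : IsTame w) : Integrable (autocorr w) :=
  hw.integrable_prod.integral_prod_left

lemma autocorr_nonneg (hw : IsTame w) (h : E n) : 0 ≤ autocorr w h :=
  integral_nonneg fun _ => mul_nonneg (hw.nonneg _) (hw.nonneg _)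

lemma integral_autocorr (hw : IsTame w) : ∫ h, autocorr w h = (∫ x, w x) ^ 2 := by
  simp only [autocorr]
  rw [integral_integral_swap (f := fun h x => w x * w (x - h)) hw.integrable_prod]
  simp only [integral_const_mul, integral_sub_left_eq_self w volume]
  rw [integral_mul_const, sq]

lemma integrable_prod_kernel (hw : IsTame w) (hk : IsKernel k) :
    Integrable (fun p : E n × E n => w p.1 * (k p.2 * w (p.1 - p.2))) (volume.prod volume) := by
  obtain ⟨C, hC⟩ := hw.exists_abs_bound
  have := hk.integrable.convolution_integrand (ContinuousLinearMap.mul ℝ ℝ)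
    hw.integrable (μ := volume)
  exact this.bdd_mul (hw.measurable.comp measurable_fst).aestronglyMeasurable
    (Eventually.of_forall fun p => hC _)

lemma integral_mul_kconv (hw : IsTame w) (hk : IsKernel k) :
    ∫ x, w x * kconv k w x = ∫ h, k h * autocorr w h := by
  have h1 : ∀ x, w x * kconv k w x = ∫ h, w x * (k h * w (x - h)) := fun x => by
    rw [integral_const_mul, kconv, ← integral_sub_left_eq_self _ volume x]
    simp
  simp only [h1]
  rw [integral_integral_swap (f := fun x h => w x * (k h * w (x - h)))
    (hw.integrable_prod_kernel hk)]
  congr 1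
  ext h
  rw [autocorr, ← integral_const_mul]
  congr 1
  ext x
  ring

lemma integrable_kernel_mul_autocorr (hw : IsTame w) (hk : IsKernel k) :
    Integrable fun h => k h * autocorr w h := by
  refine (hw.integrable_prod_kernel hk).integral_prod_right.congr (Eventually.of_forall fun h => ?_)
  simp only
  rw [autocorr, ← integral_const_mul]
  congr 1
  ext x
  ring

lemma integrable_mul_kconv (hw : IsTame w) (hk : IsKernel k) :
    Integrable fun x => w x * kconv k w x := by
  obtain ⟨C, hC⟩ := hw.exists_abs_bound
  exact (integrable_kconv hk hw.integrable).bdd_mul hw.measurable.aestronglyMeasurable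
    (Eventually.of_forall fun p => hC _)

/-- The squared distance of two translates of `w`. -/
lemma integral_shift_sub_sq (hw : IsTame w) (g h : E n) :
    ∫ x, (w (x - g) - w (x - h)) ^ 2 = 2 * ((∫ x, w x ^ 2) - autocorr w (h - g)) := by
  have h1 : ∫ x, w (x - g) * w (x - h) = autocorr w (h - g) := by
    rw [autocorr, ← integral_sub_right_eq_self (fun x => w x * w (x - (h - g))) g]
    congr 1
    ext x
    congr 2
    abel
  have h2 : ∀ g, ∫ x, w (x - g) * w (x - g) = ∫ x, w x ^ 2 := fun g => by
    rw [← integral_sub_right_eq_self (fun x => w x ^ 2) g]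
    simp only [sq]
  have h3 : ∀ x, (w (x - g) - w (x - h)) ^ 2 =
      w (x - g) * w (x - g) + w (x - h) * w (x - h) - 2 * (w (x - g) * w (x - h)) :=
    fun x => by ring
  simp only [h3]
  have h4 : Integrable fun x => w (x - g) * w (x - g) + w (x - h) * w (x - h) :=
    (hw.integrable_mul_shift g g).add (hw.integrable_mul_shift h h)
  rw [integral_sub h4
    ((hw.integrable_mul_shift g h).const_mul 2), integral_add (hw.integrable_mul_shift g g)
    (hw.integrable_mul_shift h h), integral_const_mul, h1, h2, h2]
  ring

lemma integrable_shift_sub_sq (hw : IsTame w) (g h : E n) :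
    Integrable fun x => (w (x - g) - w (x - h)) ^ 2 := by
  have h3 : (fun x => (w (x - g) - w (x - h)) ^ 2) = fun x =>
      w (x - g) * w (x - g) + w (x - h) * w (x - h) - 2 * (w (x - g) * w (x - h)) := by
    ext x
    ring
  rw [h3]
  exact ((hw.integrable_mul_shift g g).add (hw.integrable_mul_shift h h)).sub
    ((hw.integrable_mul_shift g h).const_mul 2)

lemma autocorr_le (hw : IsTame w) (h : E n) : autocorr w h ≤ ∫ x, w x ^ 2 := by
  have h1 := hw.integral_shift_sub_sq 0 h
  have h2 : 0 ≤ ∫ x, (w (x - 0) - w (x - h)) ^ 2 := integral_nonneg fun _ => sq_nonneg _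
  rw [h1, sub_zero] at h2
  linarith

/-- The defect is half the squared L² distance from w to its translate. Passing through the
translate by h and using (a + b)² ≤ 2a² + 2b² costs the factor 4. -/
lemma sub_autocorr_two_smul_le (hw : IsTame w) (h : E n) :
    (∫ x, w x ^ 2) - autocorr w ((2 : ℝ) • h) ≤ 4 * ((∫ x, w x ^ 2) - autocorr w h) := by
  have h1 := hw.integral_shift_sub_sq 0 h
  have h2 := hw.integral_shift_sub_sq h ((2 : ℝ) • h)
  have h3 := hw.integral_shift_sub_sq 0 ((2 : ℝ) • h)
  have e : (2 : ℝ) • h - h = h := by rw [two_smul]; abel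
  rw [sub_zero] at h1 h3
  rw [e] at h2
  have h4 : ∫ x, (w (x - 0) - w (x - (2 : ℝ) • h)) ^ 2 ≤
      ∫ x, (2 * (w (x - 0) - w (x - h)) ^ 2 + 2 * (w (x - h) - w (x - (2 : ℝ) • h)) ^ 2) := by
    refine integral_mono (hw.integrable_shift_sub_sq _ _)
      (((hw.integrable_shift_sub_sq _ _).const_mul 2).add
        ((hw.integrable_shift_sub_sq _ _).const_mul 2)) fun x => ?_
    nlinarith [sq_nonneg ((w (x - 0) - w (x - h)) - (w (x - h) - w (x - (2 : ℝ) • h)))]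
  rw [integral_add ((hw.integrable_shift_sub_sq _ _).const_mul 2)
    ((hw.integrable_shift_sub_sq _ _).const_mul 2), integral_const_mul, integral_const_mul,
    h1, h2, h3] at h4
  linarith

/-- This transfers the defect at large shifts, where autocorrelation must be lost, to small ones,
where k is bounded below. -/
lemma sub_autocorr_pow_smul_le (hw : IsTame w) (m : ℕ) (h : E n) :
    (∫ x, w x ^ 2) - autocorr w ((2 : ℝ) ^ m • h) ≤ 4 ^ m * ((∫ x, w x ^ 2) - autocorr w h) := by
  induction m with
  | zero => simp
  | succ m ih =>
    have := hw.sub_autocorr_two_smul_le ((2 : ℝ) ^ m • h)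
    rw [smul_smul, ← pow_succ'] at this
    rw [pow_succ' (4 : ℝ)]
    linarith

/-- Cauchy–Schwarz on the support, obtained by integrating (w - M / V)² ≥ 0 over {w > 0} with M = ∫
w. -/
lemma sq_integral_le (hw : IsTame w) {V : ℝ} (hV : 0 < V)
    (hsupp : volume {x | 0 < w x} ≤ ENNReal.ofReal V) :
    (∫ x, w x) ^ 2 ≤ V * ∫ x, w x ^ 2 := by
  have hA : MeasurableSet {x | 0 < w x} := measurableSet_lt measurable_const hw.measurable
  have hfin : volume {x | 0 < w x} ≠ ⊤ := (hsupp.trans_lt ENNReal.ofReal_lt_top).ne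
  have hvol : volume.real {x | 0 < w x} ≤ V := ENNReal.toReal_le_of_le_ofReal hV.le hsupp
  set M := ∫ x, w x with hM
  have hind : Integrable ({x | 0 < w x}.indicator fun _ => (M / V) ^ 2) :=
    (integrable_indicator_iff hA).2 (integrableOn_const hfin)
  have h1 : 0 ≤ ∫ x, (w x ^ 2 - 2 * (M / V) * w x +
      {x | 0 < w x}.indicator (fun _ => (M / V) ^ 2) x) := by
    refine integral_nonneg fun x => ?_
    by_cases hx : 0 < w x
    · have : {x | 0 < w x}.indicator (fun _ => (M / V) ^ 2) x = (M / V) ^ 2 := by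
        simp [indicator, hx]
      simp only [this, Pi.zero_apply]
      nlinarith [sq_nonneg (w x - M / V)]
    · have : w x = 0 := le_antisymm (not_lt.1 hx) (hw.nonneg x)
      simp [this]
  have hdiff : Integrable fun x => w x ^ 2 - 2 * (M / V) * w x :=
    hw.integrable_sq.sub (hw.integrable.const_mul _)
  rw [integral_add hdiff hind,
    integral_sub hw.integrable_sq (hw.integrable.const_mul _), integral_const_mul,
    integral_indicator_const _ hA, smul_eq_mul, ← hM] at h1
  have h2 : volume.real {x | 0 < w x} * (M / V) ^ 2 ≤ V * (M / V) ^ 2 :=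
    mul_le_mul_of_nonneg_right hvol (sq_nonneg _)
  have h3 : V * (M / V) ^ 2 = M ^ 2 / V := by field_simp
  have h4 : 2 * (M / V) * M = 2 * (M ^ 2 / V) := by ring
  rw [h3] at h2
  rw [h4] at h1
  have h5 : M ^ 2 / V ≤ ∫ x, w x ^ 2 := by linarith
  rwa [div_le_iff₀ hV, mul_comm] at h5

end IsTame

/-- A spectral gap for `w ↦ w - k * w` on functions whose support has measure at most `V`. -/
theorem exists_spectral_gap (hn : 0 < n) (hk : IsKernel k) {V : ℝ} (hV : 0 < V) :
    ∃ c, 0 < c ∧ ∀ w : E n → ℝ, IsTame w → volume {x | 0 < w x} ≤ ENNReal.ofReal V →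
      c * ∫ x, w x ^ 2 ≤ (∫ x, w x ^ 2) - ∫ x, w x * kconv k w x := by
  obtain ⟨r, hr, hball⟩ : ∃ r > 0, ∀ h ∈ Metric.ball (0 : E n) r, k 0 / 2 ≤ k h := by
    have : ∀ᶠ h in 𝓝 (0 : E n), k 0 / 2 < k h :=
      hk.continuous.continuousAt.eventually_const_lt (half_lt_self hk.pos_zero)
    obtain ⟨r, hr, hb⟩ := Metric.eventually_nhds_iff_ball.1 this
    exact ⟨r, hr, fun h hh => (hb h hh).le⟩
  have : Nonempty (Fin n) := ⟨⟨0, hn⟩⟩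
  have hfr : Module.finrank ℝ (E n) = n := finrank_euclideanSpace_fin
  -- The autocorrelation has total mass (∫ w)² ≤ V ∫ w², so on a ball of volume at least V + 1 its
  -- defect integrates to at least ∫ w².
  obtain ⟨m, hm⟩ : ∃ m : ℕ, V + 1 ≤ volume.real (Metric.ball (0 : E n) (2 ^ m * r)) := by
    have h1 : 0 < volume.real (Metric.ball (0 : E n) 1) :=
      ENNReal.toReal_pos (Metric.measure_ball_pos _ _ one_pos).ne' measure_ball_lt_top.ne
    have h2 : Tendsto (fun m : ℕ => (2 : ℝ) ^ m * r) atTop atTop :=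
      (tendsto_pow_atTop_atTop_of_one_lt one_lt_two).atTop_mul_const hr
    obtain ⟨m, hm1, hm2⟩ := ((h2.eventually_ge_atTop 1).and (h2.eventually_ge_atTop
      ((V + 1) / volume.real (Metric.ball (0 : E n) 1)))).exists
    refine ⟨m, ?_⟩
    rw [div_le_iff₀ h1] at hm2
    rw [measureReal_def, Measure.addHaar_ball_of_pos _ _ (by positivity), hfr, ENNReal.toReal_mul,
      ENNReal.toReal_ofReal (by positivity)]
    refine hm2.trans (mul_le_mul_of_nonneg_right ?_ h1.le)
    exact le_self_pow₀ hm1 hn.ne'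
  -- The factors are the lower bound of k near 0, the cost of m doublings, and the Jacobian of
  -- scaling by 2ᵐ.
  refine ⟨k 0 / 2 * (((4 : ℝ) ^ m)⁻¹ * (((2 : ℝ) ^ m) ^ n)⁻¹), by
    have := hk.pos_zero
    positivity, fun w hw hsupp => ?_⟩
  set a₀ := ∫ x, w x ^ 2 with ha₀
  have ha₀0 : 0 ≤ a₀ := integral_nonneg fun _ => sq_nonneg _
  have hk0 := hk.pos_zero
  have hbi : ∀ ρ, IntegrableOn (fun h => a₀ - autocorr w h) (Metric.ball 0 ρ) := fun ρ =>
    (integrableOn_const measure_ball_lt_top.ne).sub hw.integrable_autocorr.integrableOn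
  have hkb : Integrable fun h => k h * (a₀ - autocorr w h) := by
    simp only [mul_sub]
    exact (hk.integrable.mul_const _).sub (hw.integrable_kernel_mul_autocorr hk)
  have e1 : a₀ - ∫ x, w x * kconv k w x = ∫ h, k h * (a₀ - autocorr w h) := by
    rw [hw.integral_mul_kconv hk]
    simp only [mul_sub]
    rw [integral_sub (hk.integrable.mul_const _) (hw.integrable_kernel_mul_autocorr hk),
      integral_mul_const, hk.integral_eq_one, one_mul]
  have e2 : ∫ h in Metric.ball 0 r, k 0 / 2 * (a₀ - autocorr w h) ≤
      ∫ h, k h * (a₀ - autocorr w h) := by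
    refine le_trans ?_ (setIntegral_le_integral (s := Metric.ball 0 r) hkb
      (Eventually.of_forall fun h =>
        mul_nonneg (hk.nonneg h) (sub_nonneg.2 (hw.autocorr_le h))))
    refine setIntegral_mono_on ((hbi r).const_mul _) hkb.integrableOn measurableSet_ball
      fun h hh => mul_le_mul_of_nonneg_right (hball h hh) (sub_nonneg.2 (hw.autocorr_le h))
  have hsmul : (2 : ℝ) ^ m • Metric.ball (0 : E n) r = Metric.ball 0 (2 ^ m * r) := by
    rw [smul_ball (by positivity), smul_zero, Real.norm_of_nonneg (by positivity)]
  have e3 : (((2 : ℝ) ^ m) ^ n)⁻¹ * ∫ h in Metric.ball 0 (2 ^ m * r), (a₀ - autocorr w h) ≤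
      4 ^ m * ∫ h in Metric.ball 0 r, (a₀ - autocorr w h) := by
    have h1 := Measure.setIntegral_comp_smul_of_pos volume (fun h => a₀ - autocorr w h)
      (Metric.ball 0 r) (show (0 : ℝ) < 2 ^ m by positivity)
    rw [hsmul, hfr, smul_eq_mul] at h1
    rw [← h1, ← integral_const_mul]
    refine integral_mono_of_nonneg
      (Eventually.of_forall fun h => sub_nonneg.2 (hw.autocorr_le _)) ((hbi r).const_mul _)
      (Eventually.of_forall fun h => hw.sub_autocorr_pow_smul_le m h)
  have e4 : a₀ ≤ ∫ h in Metric.ball 0 (2 ^ m * r), (a₀ - autocorr w h) := by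
    have hc : IntegrableOn (fun _ : E n => a₀) (Metric.ball 0 (2 ^ m * r)) :=
      integrableOn_const measure_ball_lt_top.ne
    rw [integral_sub hc hw.integrable_autocorr.integrableOn, setIntegral_const, smul_eq_mul]
    have h1 : ∫ h in Metric.ball 0 (2 ^ m * r), autocorr w h ≤ ∫ h, autocorr w h :=
      setIntegral_le_integral hw.integrable_autocorr (Eventually.of_forall hw.autocorr_nonneg)
    rw [hw.integral_autocorr] at h1
    have h2 := hw.sq_integral_le hV hsupp
    have h3 := mul_le_mul_of_nonneg_right hm ha₀0
    linarith
  rw [e1]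
  refine le_trans ?_ e2
  rw [integral_const_mul, mul_assoc]
  refine mul_le_mul_of_nonneg_left ?_ (by positivity)
  rw [mul_assoc, inv_mul_le_iff₀ (by positivity)]
  exact (mul_le_mul_of_nonneg_left e4 (by positivity)).trans e3

/-! ### Bounds on the support and the L² norm -/

/-- The measure of the support of a function with `k * w - w ≥ ℓ 1_{w > 0} - (ℓ + G) 1_D`. -/
lemma IsTame.volume_pos_le (hk : IsKernel k) {w : E n → ℝ} (hw : IsTame w) {D : Set (E n)}
    (hD : MeasurableSet D) (hDfin : volume D ≠ ⊤) {ℓ G : ℝ} (hℓ : 0 < ℓ)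
    (hout : ∀ᵐ x, x ∉ D → 0 ≤ kconv k w x - w x)
    (hpos : ∀ᵐ x, x ∉ D → 0 < w x → ℓ ≤ kconv k w x - w x)
    (hin : ∀ᵐ x, x ∈ D → -G ≤ kconv k w x - w x) :
    volume {x | 0 < w x} ≤ volume D + ENNReal.ofReal (G / ℓ * volume.real D) := by
  have hA : MeasurableSet ({x | 0 < w x} \ D) :=
    (measurableSet_lt measurable_const hw.measurable).diff hD
  have hf : Integrable fun x => kconv k w x - w x :=
    (integrable_kconv hk hw.integrable).sub hw.integrable
  have hf0 : ∫ x, (kconv k w x - w x) = 0 := by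
    rw [integral_sub (integrable_kconv hk hw.integrable) hw.integrable,
      integral_kconv hk hw.integrable, sub_self]
  have hind : Integrable (D.indicator fun _ => G) :=
    (integrable_indicator_iff hD).2 (integrableOn_const hDfin)
  have hsum : Integrable fun x => (kconv k w x - w x) + D.indicator (fun _ => G) x := hf.add hind
  have hsum0 : 0 ≤ᵐ[volume] fun x => (kconv k w x - w x) + D.indicator (fun _ => G) x := by
    filter_upwards [hout, hin] with x h1 h2
    by_cases hx : x ∈ D
    · have := h2 hx
      simp only [Pi.zero_apply, indicator_of_mem hx]
      linarith
    · have := h1 hx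
      simpa [indicator_of_notMem hx] using this
  -- Markov's inequality: adding G on D makes k * w - w nonnegative, with total integral G |D|.
  have hle := mul_meas_ge_le_integral_of_nonneg hsum0 hsum ℓ
  rw [integral_add hf hind, hf0, zero_add, integral_indicator_const _ hD, smul_eq_mul] at hle
  have hAsub : volume ({x | 0 < w x} \ D) ≤
      volume {x | ℓ ≤ (kconv k w x - w x) + D.indicator (fun _ => G) x} := by
    refine measure_mono_ae ?_
    filter_upwards [hpos] with x h1 hx
    have := h1 hx.2 hx.1
    change ℓ ≤ (kconv k w x - w x) + D.indicator (fun _ => G) x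
    rw [indicator_of_notMem hx.2, add_zero]
    exact this
  have hfin : volume {x | ℓ ≤ (kconv k w x - w x) + D.indicator (fun _ => G) x} ≠ ⊤ :=
    (hsum.measure_ge_lt_top hℓ).ne
  have h1 : volume {x | ℓ ≤ (kconv k w x - w x) + D.indicator (fun _ => G) x} ≤
      ENNReal.ofReal (G / ℓ * volume.real D) := by
    rw [← ENNReal.ofReal_toReal hfin]
    refine ENNReal.ofReal_le_ofReal ?_
    rw [measureReal_def] at hle
    rw [div_mul_eq_mul_div, le_div_iff₀ hℓ]
    linarith
  calc volume {x | 0 < w x} ≤ volume (D ∪ ({x | 0 < w x} \ D)) :=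
        measure_mono (by rw [union_sdiff_self]; exact subset_union_right)
    _ ≤ volume D + volume ({x | 0 < w x} \ D) := measure_union_le _ _
    _ ≤ _ := add_le_add_right (hAsub.trans h1) _

/-- A uniform `L²` bound for all `w` with `k * w - w ≥ ℓ 1_{w > 0} - (ℓ + G) 1_D`. -/
theorem exists_integral_sq_bound (hn : 0 < n) (hk : IsKernel k) {D : Set (E n)}
    (hD : MeasurableSet D) (hDfin : volume D ≠ ⊤) {ℓ G : ℝ} (hℓ : 0 < ℓ) (hG : 0 < G) :
    ∃ B, ∀ w : E n → ℝ, IsTame w → (∀ᵐ x, x ∉ D → 0 ≤ kconv k w x - w x) →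
      (∀ᵐ x, x ∉ D → 0 < w x → ℓ ≤ kconv k w x - w x) →
      (∀ᵐ x, x ∈ D → -G ≤ kconv k w x - w x) → ∫ x, w x ^ 2 ≤ B := by
  obtain ⟨c, hc, hgap⟩ := exists_spectral_gap hn hk
    (V := volume.real D + G / ℓ * volume.real D + 1) (by positivity)
  refine ⟨G ^ 2 * volume.real D / c ^ 2, fun w hw hout hpos hin => ?_⟩
  have hV := hw.volume_pos_le hk hD hDfin hℓ hout hpos hin
  have h1 := hgap w hw (hV.trans (by
    rw [← ENNReal.ofReal_toReal hDfin, ← ENNReal.ofReal_add (by positivity) (by positivity)]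
    refine ENNReal.ofReal_le_ofReal ?_
    rw [measureReal_def]
    linarith))
  have hind : Integrable (D.indicator fun _ => G ^ 2 / (2 * c)) :=
    (integrable_indicator_iff hD).2 (integrableOn_const hDfin)
  -- Off D the integrand w (w - k * w) is at most 0. On D it is at most G w, and Young's inequality
  -- leaves (c / 2) w², which the gap absorbs.
  have h2 : ∫ x, (w x ^ 2 - w x * kconv k w x) ≤
      ∫ x, (c / 2 * w x ^ 2 + D.indicator (fun _ => G ^ 2 / (2 * c)) x) := by
    refine integral_mono_ae (hw.integrable_sq.sub (hw.integrable_mul_kconv hk))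
      ((hw.integrable_sq.const_mul _).add hind) ?_
    filter_upwards [hout, hin] with x h3 h4
    have hx0 := hw.nonneg x
    by_cases hx : x ∈ D
    · have h5 := h4 hx
      simp only [indicator_of_mem hx]
      have h6 : w x * (w x - kconv k w x) ≤ w x * G :=
        mul_le_mul_of_nonneg_left (by linarith) hx0
      have h7 : w x * G ≤ c / 2 * w x ^ 2 + G ^ 2 / (2 * c) := by
        have h8 : c / 2 * w x ^ 2 + G ^ 2 / (2 * c) - w x * G = (c * w x - G) ^ 2 / (2 * c) := by
          field_simp
          ring
        have : 0 ≤ (c * w x - G) ^ 2 / (2 * c) := by positivity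
        linarith
      nlinarith
    · have h5 := h3 hx
      simp only [indicator_of_notMem hx, add_zero]
      have h6 := mul_nonneg hx0 h5
      have : 0 ≤ c / 2 * w x ^ 2 := by positivity
      nlinarith
  rw [integral_sub hw.integrable_sq (hw.integrable_mul_kconv hk),
    integral_add (hw.integrable_sq.const_mul _) hind, integral_const_mul,
    integral_indicator_const _ hD, smul_eq_mul] at h2
  rw [le_div_iff₀ (by positivity)]
  have h3 : c / 2 * ∫ x, w x ^ 2 ≤ volume.real D * (G ^ 2 / (2 * c)) := by linarith
  have h4 := mul_le_mul_of_nonneg_left h3 (show 0 ≤ 2 * c by positivity)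
  have h5 : 2 * c * (volume.real D * (G ^ 2 / (2 * c))) = G ^ 2 * volume.real D := by
    field_simp
  rw [h5] at h4
  linarith

/-! ### Uniform decay of convolutions at infinity -/

/-- The tails of an integrable function are small. -/
lemma exists_tail_integral_lt {f : E n → ℝ} (hf : Integrable f) {ε : ℝ} (hε : 0 < ε) :
    ∃ ρ : ℝ, ∫ y in {y | ρ ≤ ‖y‖}, f y < ε := by
  have h1 := tendsto_setIntegral_of_antitone (f := f) (μ := volume)
    (s := fun ρ : ℝ => {y : E n | ρ ≤ ‖y‖})
    (fun ρ => measurableSet_le measurable_const measurable_norm)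
    (fun _ _ hab _ hy => le_trans hab hy) ⟨0, hf.integrableOn⟩
  have h2 : ⋂ ρ : ℝ, {y : E n | ρ ≤ ‖y‖} = ∅ := by
    refine eq_empty_of_forall_notMem fun y hy => ?_
    have : ‖y‖ + 1 ≤ ‖y‖ := mem_iInter.1 hy (‖y‖ + 1)
    linarith
  rw [h2, setIntegral_empty] at h1
  exact (h1.eventually_lt_const hε).exists

lemma IsKernel.integrable_sq (hk : IsKernel k) : Integrable fun x => k x ^ 2 := by
  have hlt := hk.memLp_top.2
  rw [eLpNorm_exponent_top] at hlt
  have hb : ∀ᵐ x, ‖k x‖ ≤ (eLpNormEssSup k volume).toReal := by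
    filter_upwards [ae_le_eLpNormEssSup (f := k) (μ := volume)] with y hy
    rw [← toReal_enorm]
    exact ENNReal.toReal_mono hlt.ne hy
  simpa only [sq] using hk.integrable.mul_bdd hk.integrable.aestronglyMeasurable hb

lemma mul_le_weighted_sq {p q g a : ℝ} (ha : 0 < a) (hg : q ^ 2 ≤ g) :
    p * q ≤ a / 2 * p ^ 2 + 1 / (2 * a) * g := by
  have h1 : a / 2 * p ^ 2 + 1 / (2 * a) * q ^ 2 - p * q = (a * p - q) ^ 2 / (2 * a) := by
    field_simp
    ring
  have h2 : 0 ≤ (a * p - q) ^ 2 / (2 * a) := by positivity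
  have h3 : 1 / (2 * a) * q ^ 2 ≤ 1 / (2 * a) * g := mul_le_mul_of_nonneg_left hg (by positivity)
  linarith

/-- Convolutions with functions whose squares have a common integrable majorant vanish at
infinity, uniformly. -/
lemma exists_kconv_lt_of_sq_le (hk : IsKernel k) {g : E n → ℝ} (hg : Integrable g)
    (hg0 : ∀ y, 0 ≤ g y) {ε : ℝ} (hε : 0 < ε) :
    ∃ R : ℝ, ∀ w : E n → ℝ, (∀ y, 0 ≤ w y) → (∀ᵐ y, w y ^ 2 ≤ g y) →
      ∀ x, R ≤ ‖x‖ → kconv k w x < ε := by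
  have hK0 : 0 ≤ ∫ y, k y ^ 2 := integral_nonneg fun _ => sq_nonneg _
  have hW0 : 0 ≤ ∫ y, g y := integral_nonneg hg0
  -- The Young weights a and b make the two full integrals cost at most ε/4 each; the radii ρ and ρ'
  -- are then chosen to make the two tails cost less than ε/4 each.
  obtain ⟨a, ha, haK⟩ : ∃ a, 0 < a ∧ a / 2 * ∫ y, k y ^ 2 ≤ ε / 4 :=
    ⟨ε / (2 * ((∫ y, k y ^ 2) + 1)), by positivity, by
      rw [div_div, div_mul_eq_mul_div, div_le_div_iff₀ (by positivity) (by norm_num)]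
      nlinarith⟩
  obtain ⟨b, hb, hbW⟩ : ∃ b, 0 < b ∧ b / 2 * ∫ y, g y ≤ ε / 4 :=
    ⟨ε / (2 * ((∫ y, g y) + 1)), by positivity, by
      rw [div_div, div_mul_eq_mul_div, div_le_div_iff₀ (by positivity) (by norm_num)]
      nlinarith⟩
  obtain ⟨ρ, hρ⟩ := exists_tail_integral_lt hg (show 0 < a * ε / 2 by positivity)
  obtain ⟨ρ', hρ'⟩ := exists_tail_integral_lt hk.integrable_sq (show 0 < b * ε / 2 by positivity)
  refine ⟨ρ + ρ', fun w hw0 hw x hx => ?_⟩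
  have hT : ∀ r : ℝ, MeasurableSet {y : E n | r ≤ ‖y‖} := fun r =>
    measurableSet_le measurable_const measurable_norm
  set P : E n → ℝ := {y : E n | ρ' ≤ ‖y‖}.indicator fun y => k y ^ 2 with hP
  set Q : E n → ℝ := {y : E n | ρ ≤ ‖y‖}.indicator g with hQ
  have hPi : Integrable P := hk.integrable_sq.indicator (hT _)
  have hQi : Integrable Q := hg.indicator (hT _)
  have hP0 : ∀ y, 0 ≤ P y := fun y => indicator_nonneg (fun _ _ => sq_nonneg _) y
  have hQ0 : ∀ y, 0 ≤ Q y := fun y => indicator_nonneg (fun _ _ => hg0 _) y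
  have i1 : Integrable fun y => 1 / (2 * b) * P (x - y) := (hPi.comp_sub_left x).const_mul _
  have i2 : Integrable fun y => a / 2 * k (x - y) ^ 2 :=
    (hk.integrable_sq.comp_sub_left x).const_mul _
  have i3 : Integrable fun y => b / 2 * g y := hg.const_mul _
  have i4 : Integrable fun y => 1 / (2 * a) * Q y := hQi.const_mul _
  have hle : kconv k w x ≤ ∫ y, (1 / (2 * b) * P (x - y) + a / 2 * k (x - y) ^ 2 +
      (b / 2 * g y + 1 / (2 * a) * Q y)) := by
    refine integral_mono_of_nonneg
      (Eventually.of_forall fun y => mul_nonneg (hk.nonneg _) (hw0 _))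
      ((i1.add i2).add (i3.add i4)) (hw.mono fun y hy => ?_)
    have p1 : 0 ≤ 1 / (2 * b) * P (x - y) := mul_nonneg (by positivity) (hP0 _)
    have p2 : 0 ≤ a / 2 * k (x - y) ^ 2 := by positivity
    have p3 : 0 ≤ b / 2 * g y := mul_nonneg (by positivity) (hg0 _)
    have p4 : 0 ≤ 1 / (2 * a) * Q y := mul_nonneg (by positivity) (hQ0 _)
    -- Since ‖x‖ ≥ ρ + ρ', either y lies in the tail of g or x - y lies in the tail of k².
    by_cases hyρ : ρ ≤ ‖y‖
    · have h1 := mul_le_weighted_sq (p := k (x - y)) ha hy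
      have h2 : Q y = g y := indicator_of_mem (s := {y : E n | ρ ≤ ‖y‖}) hyρ g
      rw [← h2] at h1
      linarith
    · have hmem : ρ' ≤ ‖x - y‖ := by
        have := norm_sub_norm_le x y
        linarith [not_le.1 hyρ]
      have h1 := mul_le_weighted_sq (p := k (x - y)) (show 0 < 1 / b by positivity) hy
      have h2 : P (x - y) = k (x - y) ^ 2 :=
        indicator_of_mem (s := {y : E n | ρ' ≤ ‖y‖}) hmem _
      have h3 : 1 / (2 * (1 / b)) = b / 2 := by field_simp
      have h4 : 1 / b / 2 = 1 / (2 * b) := by field_simp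
      rw [h3, h4, ← h2] at h1
      linarith
  have i12 : Integrable fun y => 1 / (2 * b) * P (x - y) + a / 2 * k (x - y) ^ 2 := i1.add i2
  have i34 : Integrable fun y => b / 2 * g y + 1 / (2 * a) * Q y := i3.add i4
  rw [integral_add i12 i34, integral_add i1 i2, integral_add i3 i4,
    integral_const_mul, integral_const_mul, integral_const_mul, integral_const_mul,
    integral_sub_left_eq_self P volume x,
    integral_sub_left_eq_self (fun y => k y ^ 2) volume x, hP, hQ, integral_indicator (hT _),
    integral_indicator (hT _)] at hle
  have t1 : 1 / (2 * b) * ∫ y in {y : E n | ρ' ≤ ‖y‖}, k y ^ 2 < ε / 4 := by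
    have := mul_lt_mul_of_pos_left hρ' (show 0 < 1 / (2 * b) by positivity)
    have e : 1 / (2 * b) * (b * ε / 2) = ε / 4 := by field_simp; norm_num
    linarith
  have t2 : 1 / (2 * a) * ∫ y in {y : E n | ρ ≤ ‖y‖}, g y < ε / 4 := by
    have := mul_lt_mul_of_pos_left hρ (show 0 < 1 / (2 * a) by positivity)
    have e : 1 / (2 * a) * (a * ε / 2) = ε / 4 := by field_simp; norm_num
    linarith
  linarith

/-- A nondecreasing sequence that is bounded in `L²` has an integrable majorant of its squares. -/
lemma exists_integrable_sq_majorant {w : ℕ → E n → ℝ} (hw : ∀ j, IsTame (w j))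
    (hmono : ∀ i j, i ≤ j → ∀ x, w i x ≤ w j x) {B : ℝ} (hB : ∀ j, ∫ x, w j x ^ 2 ≤ B) :
    ∃ g : E n → ℝ, Integrable g ∧ (∀ y, 0 ≤ g y) ∧ ∀ j, ∀ᵐ y, w j y ^ 2 ≤ g y := by
  have hm : ∀ j, Measurable fun y => ENNReal.ofReal (w j y ^ 2) := fun j =>
    ((hw j).measurable.pow_const 2).ennreal_ofReal
  have hint : ∫⁻ y, ⨆ j, ENNReal.ofReal (w j y ^ 2) ≤ ENNReal.ofReal B := by
    rw [lintegral_iSup hm fun i j hij y => ENNReal.ofReal_le_ofReal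
      (pow_le_pow_left₀ ((hw i).nonneg y) (hmono i j hij y) 2)]
    refine iSup_le fun j => ?_
    rw [← ofReal_integral_eq_lintegral_ofReal (hw j).integrable_sq
      (Eventually.of_forall fun _ => sq_nonneg _)]
    exact ENNReal.ofReal_le_ofReal (hB j)
  have hne : ∫⁻ y, ⨆ j, ENNReal.ofReal (w j y ^ 2) ≠ ⊤ :=
    (hint.trans_lt ENNReal.ofReal_lt_top).ne
  have hsm : Measurable fun y => ⨆ j, ENNReal.ofReal (w j y ^ 2) := Measurable.iSup hm
  refine ⟨fun y => (⨆ j, ENNReal.ofReal (w j y ^ 2)).toReal,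
    integrable_toReal_of_lintegral_ne_top hsm.aemeasurable hne,
    fun y => ENNReal.toReal_nonneg, fun j => ?_⟩
  filter_upwards [ae_lt_top hsm hne] with y hy
  rw [← ENNReal.ofReal_le_iff_le_toReal hy.ne]
  exact le_iSup (fun j => ENNReal.ofReal (w j y ^ 2)) j

/-! ### Boundedness of the regions -/

section Solution

variable {d : ℝ} {γ₀ : E n → ℝ} {γ : ℝ → E n → ℝ}

/-- The regions of a single solution stay in a fixed ball. -/
theorem IsSolution.exists_region_subset_ball (hn : 0 < n) (hk : IsKernel k) (hd : 0 < d)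
    {Ω₀ : Set (E n)} (hΩ₀ : Bornology.IsBounded Ω₀) {ℓ₀ : ℝ} (hℓ₀ : 0 < ℓ₀)
    (h0 : IsOnePhaseInitialData Ω₀ ℓ₀ γ₀) (hcont : ContinuousOn γ₀ (closure Ω₀))
    (h : IsSolution d k γ₀ γ) :
    ∃ R : ℝ, 0 < R ∧ ∀ t, 0 < t → region γ t ⊆ Metric.ball 0 R := by
  have hDc : IsCompact (closure Ω₀) := hΩ₀.isCompact_closure
  have hDm : MeasurableSet (closure Ω₀) := isClosed_closure.measurableSet
  have hDfin : volume (closure Ω₀) ≠ ⊤ := hDc.measure_lt_top.ne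
  obtain ⟨G₀, hG₀⟩ := hDc.exists_bound_of_continuousOn hcont
  set G := |G₀| + 1 with hGdef
  have hGpos : 0 < G := by positivity
  have hG : ∀ x ∈ closure Ω₀, γ₀ x ≤ G := fun x hx => by
    have h1 := hG₀ x hx
    rw [Real.norm_eq_abs] at h1
    linarith [le_abs_self (γ₀ x), le_abs_self G₀]
  have hi : Integrable (posPart γ 0) := by
    have hind : Integrable ((closure Ω₀).indicator fun _ => G) :=
      (integrable_indicator_iff hDm).2 (integrableOn_const hDfin)
    refine hind.mono (h.aestronglyMeasurable_posPart h0.memLp_top le_rfl)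
      (Eventually.of_forall fun x => ?_)
    rw [Real.norm_eq_abs, abs_of_nonneg (posPart_nonneg _ _ _)]
    refine le_trans ?_ (le_abs_self _)
    by_cases hx : x ∈ closure Ω₀
    · rw [indicator_of_mem hx, posPart, h.initial]
      exact max_le (hG x hx) hGpos.le
    · rw [indicator_of_notMem hx, posPart, h.initial, h0.eq_outside x hx]
      exact max_le (by linarith) le_rfl
  obtain ⟨w, hwm, hw0, hwmono, hwi, hwb, hwpos, hweq, hwle⟩ :=
    h.exists_accumulated hk hd h0.memLp_top hi
  have htame : ∀ t, 0 ≤ t → IsTame (w t) := fun t ht =>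
    ⟨hwm t ht, hwi t ht, fun x => hw0 t x ht, hwb t ht⟩
  obtain ⟨B, hB⟩ := exists_integral_sq_bound hn hk hDm hDfin hℓ₀ hGpos
  have hsq : ∀ t, 0 ≤ t → ∫ x, w t x ^ 2 ≤ B := by
    intro t ht
    refine hB (w t) (htame t ht) ?_ ?_ ?_
    · filter_upwards [hweq t ht] with x hx hxD
      -- If γ(t, x) ≤ 0, then γ(·, x) was never positive before t, since e^{dt} γ⁺ is nondecreasing;
      -- so it has not decreased.
      have h1 : γ 0 x ≤ γ t x := by
        rcases le_total 0 (γ t x) with h2 | h2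
        · rw [h.initial, h0.eq_outside x hxD]
          linarith
        · refine h.le_of_nonpos hk hd le_rfl ht fun r hr => ?_
          by_contra hcon
          have hpos : posPart γ r x = γ r x := max_eq_left (not_le.1 hcon).le
          have h3 := h.posPart_le hk hd hr.1.le hr.2.le x
          rw [hpos, show posPart γ t x = 0 from max_eq_right h2, mul_zero] at h3
          exact hcon h3
      rw [h.initial] at h1
      linarith
    · filter_upwards [hweq t ht] with x hx hxD hpos
      have h1 := hwpos t x ht hpos
      rw [h0.eq_outside x hxD] at hx
      linarith
    · filter_upwards [hweq t ht] with x hx hxD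
      have h1 : 0 ≤ γ t x := h.nonneg_of_nonneg hk hd le_rfl ht (by
        rw [h.initial]
        exact h0.nonneg_inside x hxD)
      have h2 := hG x hxD
      linarith
  -- Integer times suffice because w is nondecreasing in time.
  obtain ⟨g, hgi, hg0, hg⟩ := exists_integrable_sq_majorant (w := fun j : ℕ => w j)
    (fun j => htame j j.cast_nonneg)
    (fun i j hij x => hwmono i j x i.cast_nonneg (Nat.cast_le.2 hij))
    (fun j => hsq j j.cast_nonneg)
  obtain ⟨R₁, hR₁⟩ := exists_kconv_lt_of_sq_le hk hgi hg0 hℓ₀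
  obtain ⟨R₂, hR₂⟩ := hDc.isBounded.subset_ball 0
  refine ⟨max 1 (max R₁ R₂), by positivity, fun t ht x hx => ?_⟩
  by_cases hxD : x ∈ closure Ω₀
  · exact Metric.ball_subset_ball ((le_max_right _ _).trans (le_max_right _ _)) (hR₂ hxD)
  rw [mem_ball_zero_iff]
  by_contra hcon
  obtain ⟨j, hj⟩ := exists_nat_ge t
  have h1 := hR₁ (w t) (fun y => hw0 t y ht.le) ((hg j).mono fun y hy =>
    (pow_le_pow_left₀ (hw0 t y ht.le) (hwmono t j y ht.le hj) 2).trans hy) x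
    (((le_max_left _ _).trans (le_max_right _ _)).trans (not_lt.1 hcon))
  have h2 := hwle t ht.le x
  rw [h0.eq_outside x hxD] at h2
  have h3 : 0 ≤ γ t x := hx
  linarith

/-- All solutions, for all diffusion rates, have their regions in a common ball. -/
theorem exists_uniform_region_subset_ball (hk : IsKernel k) {Ω₀ : Set (E n)}
    (hΩ₀ : Bornology.IsBounded Ω₀) {ℓ₀ : ℝ} (hℓ₀ : 0 < ℓ₀)
    (h0 : IsOnePhaseInitialData Ω₀ ℓ₀ γ₀) (hcont : ContinuousOn γ₀ (closure Ω₀)) :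
    ∃ R : ℝ, 0 < R ∧ ∀ (d : ℝ) (γ : ℝ → E n → ℝ), 0 < d → IsSolution d k γ₀ γ →
      ∀ t : ℝ, 0 < t → region γ t ⊆ Metric.ball 0 R := by
  -- The spectral gap needs n > 0 for balls of large volume; for n = 0 the space is a point.
  rcases Nat.eq_zero_or_pos n with rfl | hn
  · exact ⟨1, one_pos, fun d γ _ _ t _ x _ => by simp [Subsingleton.elim x 0]⟩
  -- The radius of any one solution serves for all; if there is no solution the claim is vacuous.
  by_cases hex : ∃ (d : ℝ) (γ : ℝ → E n → ℝ), 0 < d ∧ IsSolution d k γ₀ γ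
  · obtain ⟨d₁, γ₁, hd₁, h₁⟩ := hex
    obtain ⟨R, hR, hsub⟩ := h₁.exists_region_subset_ball hn hk hd₁ hΩ₀ hℓ₀ h0 hcont
    refine ⟨R, hR, fun d γ hd h t ht x hx => ?_⟩
    have h₂ := h₁.comp_mul (show 0 < d / d₁ by positivity)
    rw [div_mul_cancel₀ d hd₁.ne'] at h₂
    refine hsub (d / d₁ * t) (by positivity) ?_
    have h3 : 0 ≤ γ t x := hx
    rw [h.unique hk hd h0.memLp_top h₂ ht.le x] at h3
    exact h3
  · exact ⟨1, one_pos, fun d γ hd h => absurd ⟨d, γ, hd, h⟩ hex⟩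

end Solution

end NonlocalStefan

end

theorem theorem1p5 {n : ℕ} (k : NonlocalStefan.E n → ℝ) (hk : NonlocalStefan.IsKernel k)
    (Ω₀ : Set (NonlocalStefan.E n)) (hΩ₀ : NonlocalStefan.IsSmoothBoundedDomain Ω₀)
    (ℓ₀ : ℝ) (hℓ₀ : 0 < ℓ₀)
    (γ₀ : NonlocalStefan.E n → ℝ) (hγ₀ : NonlocalStefan.IsOnePhaseInitialData Ω₀ ℓ₀ γ₀)
    (hcont : ContinuousOn γ₀ (closure Ω₀)) :
    (∀ (d : ℝ) (γ : ℝ → NonlocalStefan.E n → ℝ), 0 < d →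
      NonlocalStefan.IsSolution d k γ₀ γ →
        (∃ t₀ : ℝ, 0 < t₀ ∧ ∀ t, 0 ≤ t → t ≤ t₀ →
          NonlocalStefan.region γ t = NonlocalStefan.region γ 0) ∧
        (∀ t₁ t₂ : ℝ, 0 < t₁ → t₁ < t₂ →
          NonlocalStefan.region γ t₁ ⊆ NonlocalStefan.region γ t₂)) ∧
    (∃ R : ℝ, 0 < R ∧ ∀ (d : ℝ) (γ : ℝ → NonlocalStefan.E n → ℝ), 0 < d →
      NonlocalStefan.IsSolution d k γ₀ γ →
        ∀ t : ℝ, 0 < t → NonlocalStefan.region γ t ⊆ Metric.ball 0 R) := by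
  refine ⟨fun d γ hd h => ⟨h.exists_region_eq hk hd hℓ₀ hγ₀, fun t₁ t₂ ht₁ ht x hx =>
    h.nonneg_of_nonneg hk hd ht₁.le ht.le hx⟩, ?_⟩
  exact NonlocalStefan.exists_uniform_region_subset_ball hk hΩ₀.isBounded hℓ₀ hγ₀ hcont
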